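/- Let $n,m,d\ge 1$ be integers with $\gcd(n,m)=1$, and let $C$ be a generic curve, i.e. the plane curve germ parametrized by $$x(t)=t^{nd},\qquad y(t)=t^{md}+\lambda t^{md+1}+\dots\in\mathbb C[[t]],\qquad \lambda\neq 0,$$ where the higher coefficients of $y$ are arbitrary. Let $\mathcal O_C=\mathbb C[[x(t),y(t)]]\subset\mathbb C[[t]]$. Let $\Delta\subset\mathbb Z_{\ge 0}$ be cofinite and $(nd,md)$-invariant, i.e. $\Delta+nd\subset\Delta$ and $\Delta+md\subset\Delta$. An $(nd)$-generator of $\Delta$ is an element $a\in\Delta$ with $a-nd\notin\Delta$. For a remainder $j$ modulo $d$, denote by $a_{j,i}$ the $(nd)$-generators of $\Delta$ congruent to $j$ modulo $d$, and put $\mathrm{Gaps}(x)=[x,\infty)\setminus\Delta$. Assume that $\Delta$ is admissible: for every remainder $j$ modulo $d$ there is some $i$ with $a_{j,i}+md+1\in\Delta$. Let $J_\Delta$ be the corresponding stratum of the compactified Jacobian of $C$. Its points are $$J_\Delta=\{M\subset\mathbb C[[t]]\ :\ M \text{ an } \mathcal O_C\text{-submodule},\ \{\mathrm{Ord}\, f: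 0\ne f\in M\}=\Delta\}.$$ As a scheme over $\mathbb C$ it is given by its functor of points: for a commutative $\mathbb C$-algebra $R$, the set $J_\Delta(R)$ consists of the $R[[x(t),y(t)]]$-submodules $M\subset R[[t]]$ such that, for every $k\ge 0$, the set of coefficients of $t^k$ of the elements of $M\cap t^kR[[t]]$ is $R$ if $k\in\Delta$ and $\{0\}$ if $k\notin\Delta$. A homomorphism $R\to S$ sends $M\in J_\Delta(R)$ to the $S[[x(t),y(t)]]$-submodule of $S[[t]]$ generated by the image of $M$. Then $J_\Delta$ is isomorphic over $\mathbb C$ to the affine space $\mathbb A^{D}$ of dimension $$D=\sum_{j,i}\bigl(|\mathrm{Gaps}(a_{j,i})|-|\mathrm{Gaps}(a_{j,i}+md)|\bigr),$$ where the sum is over all $(nd)$-generators of $\Delta$. That is, there are bijections $R^{D}\to J_\Delta(R)$, natural in the commutative $\mathbb C$-algebra $R$. -/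

import Mathlib

open scoped PowerSeries

/-- A generic curve singularity with parameters `n, m, d ≥ 1`, `gcd (n, m) = 1`: the germ with the
parametrization `x(t) = t^(nd)`, `y(t) = t^(md) + λ t^(md+1) + …`, `λ ≠ 0`. The datum is the power
series `y(t)`, whose coefficients beyond `t^(md+1)` are arbitrary complex numbers. -/
structure GenericCurve (n m d : ℕ) where
  n_pos : 0 < n
  m_pos : 0 < m
  d_pos : 0 < d
  coprime : Nat.Coprime n m
  /-- the second coordinate of the parametrization -/
  y : ℂ⟦X⟧
  coeff_y_lt : ∀ k < m * d, PowerSeries.coeff k y = 0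
  coeff_y_md : PowerSeries.coeff (m * d) y = 1
  coeff_y_md_succ : PowerSeries.coeff (m * d + 1) y ≠ 0

namespace GenericCurve

variable {n m d : ℕ}

/-- The parametrization `(x(t), y(t))`, with coefficients viewed in a `ℂ`-algebra `R`. -/
noncomputable def param (C : GenericCurve n m d) (R : Type) [CommRing R] [Algebra ℂ R] :
    Fin 2 → R⟦X⟧ :=
  ![PowerSeries.X ^ (n * d), PowerSeries.map (algebraMap ℂ R) C.y]

theorem hasSubst_param (C : GenericCurve n m d) (R : Type) [CommRing R] [Algebra ℂ R] :
    MvPowerSeries.HasSubst (C.param R) := by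
  have hn := C.n_pos
  have hm := C.m_pos
  have hd := C.d_pos
  refine MvPowerSeries.hasSubst_of_constantCoeff_zero fun i => ?_
  change PowerSeries.constantCoeff (C.param R i) = 0
  fin_cases i
  · simp [param, hn.ne', hd.ne']
  · have h := C.coeff_y_lt 0 (Nat.mul_pos hm hd)
    rw [PowerSeries.coeff_zero_eq_constantCoeff_apply] at h
    simp [param, ← PowerSeries.coeff_zero_eq_constantCoeff_apply, h]

/-- The ring of functions `R[[x(t), y(t)]] ⊆ R[[t]]`: all `F(x(t), y(t))`, where `F` is a formal
power series in two variables over `R`. For `R = ℂ` this is the local ring `𝒪_C` of the curve. -/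
noncomputable def functionRing (C : GenericCurve n m d) (R : Type) [CommRing R] [Algebra ℂ R] :
    Subalgebra R R⟦X⟧ :=
  (MvPowerSeries.substAlgHom (R := R) (C.hasSubst_param R)).range

end GenericCurve

section Strata

variable {R : Type} [CommRing R] {O : Subalgebra R R⟦X⟧}

/-- The set of orders `Δ_M = {Ord f : f ∈ M, f ≠ 0} ⊆ ℕ` of a submodule `M ⊆ R[[t]]`. -/
def orderSet (M : Submodule O R⟦X⟧) : Set ℕ :=
  {k | ∃ f ∈ M, PowerSeries.order f = k}

/-- The ideal of leading coefficients of `M` in degree `k`: the coefficients of `t^k` of all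
elements of `M ∩ t^k R[[t]]`. -/
def leadingCoeffs (M : Submodule O R⟦X⟧) (k : ℕ) : Set R :=
  {c | ∃ f ∈ M, (∀ i < k, PowerSeries.coeff i f = 0) ∧ PowerSeries.coeff k f = c}

end Strata

namespace GenericCurve

variable {n m d : ℕ}

/-- The set of points of the stratum `J_Δ` of the compactified Jacobian:
the `𝒪_C`-submodules `M ⊆ ℂ[[t]]` with `Δ_M = Δ`. -/
def stratum (C : GenericCurve n m d) (Δ : Set ℕ) : Set (Submodule (C.functionRing ℂ) ℂ⟦X⟧) :=
  {M | orderSet M = Δ}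

/-- The functor of points of `J_Δ`, as a scheme over `ℂ`, on a `ℂ`-algebra `R`. It consists of the
families over `Spec R` of submodules of type `Δ`, that is, of the `R[[x(t), y(t)]]`-submodules
`M ⊆ R[[t]]` whose ideal of leading coefficients in degree `k` is the unit ideal for `k ∈ Δ` and
zero for `k ∉ Δ` (the Schubert cell of type `Δ`). -/
def stratumPoints (C : GenericCurve n m d) (Δ : Set ℕ) (R : Type) [CommRing R] [Algebra ℂ R] :
    Set (Submodule (C.functionRing R) R⟦X⟧) :=
  {M | (∀ k ∈ Δ, leadingCoeffs M k = Set.univ) ∧ ∀ k ∉ Δ, leadingCoeffs M k = {0}}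

/-- Over `ℂ` the functor of points gives the points of the stratum. -/
theorem stratumPoints_complex (C : GenericCurve n m d) (Δ : Set ℕ) :
    C.stratumPoints Δ ℂ = C.stratum Δ := by
  ext M
  simp only [stratumPoints, stratum, Set.mem_ofPred_eq]
  have key : ∀ k, k ∈ orderSet M ↔ ∃ c ∈ leadingCoeffs M k, c ≠ 0 := by
    intro k
    simp only [orderSet, leadingCoeffs, Set.mem_ofPred_eq, PowerSeries.order_eq_nat]
    constructor
    · rintro ⟨f, hf, h0, h1⟩
      exact ⟨_, ⟨f, hf, h1, rfl⟩, h0⟩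
    · rintro ⟨c, ⟨f, hf, h1, rfl⟩, h0⟩
      exact ⟨f, hf, h0, h1⟩
  constructor
  · rintro ⟨h1, h2⟩
    ext k
    rw [key]
    constructor
    · rintro ⟨c, hc, h0⟩
      by_contra hk
      rw [h2 k hk] at hc
      exact h0 hc
    · intro hk
      exact ⟨1, by rw [h1 k hk]; trivial, one_ne_zero⟩
  · rintro rfl
    refine ⟨fun k hk => ?_, fun k hk => ?_⟩
    · obtain ⟨c, ⟨f, hf, h1, rfl⟩, h0⟩ := (key k).1 hk
      refine Set.eq_univ_of_forall fun e => ?_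
      have hs : ∀ a : ℂ, a • f ∈ M := fun a => by
        have := M.smul_mem (algebraMap ℂ (C.functionRing ℂ) a) hf
        rwa [algebraMap_smul] at this
      refine ⟨(e / PowerSeries.coeff k f) • f, hs _, fun i hi => by simp [h1 i hi], ?_⟩
      simp [h0]
    · ext c
      rw [key] at hk
      push Not at hk
      exact ⟨fun hc => hk c hc, by rintro rfl; exact ⟨0, M.zero_mem, by simp, by simp⟩⟩

/-- Base change of families along `f : R → S`: the submodule of `S[[t]]` generated over
`S[[x(t), y(t)]]` by the image of `M`. -/
noncomputable def baseChange (C : GenericCurve n m d) {R S : Type} [CommRing R] [Algebra ℂ R]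
    [CommRing S] [Algebra ℂ S] (f : R →ₐ[ℂ] S) (M : Submodule (C.functionRing R) R⟦X⟧) :
    Submodule (C.functionRing S) S⟦X⟧ :=
  Submodule.span (C.functionRing S) (PowerSeries.map (f : R →+* S) '' (M : Set R⟦X⟧))

end GenericCurve

/-- `Δ` is closed under adding `k`. -/
def IsShiftInvariant (Δ : Set ℕ) (k : ℕ) : Prop :=
  ∀ a ∈ Δ, a + k ∈ Δ

/-- The `k`-generators of `Δ`: the `a ∈ Δ` with `a - k ∉ Δ`. -/
def generators (Δ : Set ℕ) (k : ℕ) : Set ℕ :=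
  {a | a ∈ Δ ∧ ∀ b ∈ Δ, b + k ≠ a}

/-- `Gaps(x) = [x, ∞) \ Δ`. -/
def gaps (Δ : Set ℕ) (x : ℕ) : Set ℕ :=
  Set.Ici x \ Δ

/-- `x > 0` is `j`-suspicious: `a + md + x ∉ Δ` for all `nd`-generators `a` of `Δ` with
`a ≡ j mod d`. -/
def IsSuspiciousAt (n m d : ℕ) (Δ : Set ℕ) (j x : ℕ) : Prop :=
  0 < x ∧ ∀ a ∈ generators Δ (n * d), a ≡ j [MOD d] → a + m * d + x ∉ Δ

/-- `x` is suspicious: it is `j`-suspicious for at least one remainder `j` modulo `d`. -/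
def IsSuspicious (n m d : ℕ) (Δ : Set ℕ) (x : ℕ) : Prop :=
  ∃ j < d, IsSuspiciousAt n m d Δ j x

/-- `Δ` is admissible: `1` is not suspicious for `Δ`. -/
def IsAdmissible (n m d : ℕ) (Δ : Set ℕ) : Prop :=
  ¬ IsSuspicious n m d Δ 1

/-!
Write `N = n * d`, `M = m * d`, and let `gen r` be the least element of `Δ` in the residue class `r`
modulo `N`; these are the `N`-generators of `Δ`. A point of `J_Δ` over `R` is free over
`R[[x]] = R[[t ^ N]]`, and it has exactly one basis of the form
`f_r = t ^ gen r * ∑ l, g l r * t ^ l`, with `g 0 r = 1` and `g l r = 0` for `l > 0` and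
`gen r + l ∈ Δ`. So there is one variable `g l r`, of weight `l`, for each element of `Gaps(gen r)`.
Put `H_r = ∑ l, g l r * t ^ l`. The basis spans a point of `J_Δ` if and only if there are expansions
`y f_r = ∑ s, c s r * t ^ (gen r + M + s) * H_(r + M + s)` with `c s r = 0` whenever
`gen r + M + s` is a gap; when the coefficients `c` are eliminated recursively, one equation is left
for every element of `Gaps(gen r + M)`. In weight `s` it reads
`g s r - g s (r + M) + (terms of lower weight) = 0` (`Staircase.residual_succ`).

For fixed `s`, these equations run along the orbits of `r ↦ r + M`, which are the classes modulo
`d`. If some residue of a class has no equation, the equations of the class are independent, and the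
variables at the ends of the remaining paths are free (`Staircase.exists_eqn_solution`). Otherwise
the class is suspicious in weight `s`, and the sum of its equations is a condition on the variables
of weight at most `s - 1`. Genericity enters here: a common shift by `k` of the variables of weight
`s - 1` in the *next* class changes the sum by `- n * λ * k` (`Staircase.sum_low_sub`), so the sum
determines one free variable of this class, which exists by admissibility. The classes of a given
weight are never all suspicious (`Staircase.exists_not_susp`), so they can be treated one after the
other, starting after a class that is not suspicious. The outcome is that over every `R` a solution
exists and is unique for prescribed values of a set of free coordinates, which are linear forms over
`ℤ` in the `g l r` (`Staircase.exists_solution`, `Staircase.IsSolution.ext_coord`); naturality in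
`R` follows from uniqueness. As admissibility excludes suspicious classes in weight `1`, the numbers
of dependent and of additional equations balance, and the number of free coordinates is the number
of variables minus the number of equations (`Staircase.card_freeIndices`).
-/

open Finset.HasAntidiagonal (antidiagonal)

/-! ### Paths in the residue classes -/

/-- The combinatorial type of a subset of `ℕ` that is stable under adding `N` and `M`, recorded by
the function `gen` that sends a residue modulo `N` to the least element of the subset in this
residue class; so `k` lies in the subset if and only if `gen k ≤ k`. Adding `M` permutes the
residues modulo `N` in each class modulo `d` transitively. The last field is admissibility. -/
structure Staircase (N d M : ℕ) where
  gen : ZMod N → ℕ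
  gen_add : ∀ r, gen (r + M) ≤ gen r + M
  dvd_N : d ∣ N
  dvd_M : d ∣ M
  exists_eq_add : ∀ r r' : ZMod N, ZMod.castHom dvd_N (ZMod d) r = ZMod.castHom dvd_N (ZMod d) r' →
    ∃ i : ℕ, r' = r + i * M
  admissible : ∀ j : ZMod d, ∃ r, ZMod.castHom dvd_N (ZMod d) r = j ∧ gen (r + M + 1) ≤ gen r + M + 1

namespace Staircase

variable {N d M : ℕ} (T : Staircase N d M)

/-- The class modulo `d` of a residue modulo `N`. -/
def cl (r : ZMod N) : ZMod d := ZMod.castHom T.dvd_N (ZMod d) r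

theorem cl_add (r s : ZMod N) : T.cl (r + s) = T.cl r + T.cl s := map_add _ _ _

theorem cl_add_M (r : ZMod N) : T.cl (r + M) = T.cl r := by
  rw [cl_add]
  have : T.cl (M : ZMod N) = (M : ZMod d) := map_natCast _ _
  rw [this, (ZMod.natCast_eq_zero_iff _ _).2 T.dvd_M, add_zero]

theorem cl_add_M_add_one (r : ZMod N) : T.cl (r + M + 1) = T.cl r + 1 := by
  rw [cl_add, cl_add_M, show T.cl 1 = 1 from map_one _]

theorem cl_add_mul (r : ZMod N) (i : ℕ) : T.cl (r + i * M) = T.cl r := by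
  induction i with
  | zero => simp
  | succ i ih =>
    rw [← ih, ← T.cl_add_M (r + i * M)]
    congr 1
    push_cast
    ring

/-- The exponent `gen r + s` is a gap: the basis element of order `gen r` has a free coefficient
`s` steps above its leading term. -/
def IsVar (s : ℕ) (r : ZMod N) : Prop := T.gen r + s < T.gen (r + s)

/-- The exponent `gen r + M + s` is a gap: it imposes an equation of weight `s`. -/
def IsEqn (s : ℕ) (r : ZMod N) : Prop := T.gen r + M + s < T.gen (r + M + s)

/-- All the residues of the class `j` carry an equation of weight `s`. -/
def Susp (s : ℕ) (j : ZMod d) : Prop := ∀ r, T.cl r = j → T.IsEqn s r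

variable {T}

theorem IsEqn.isVar {s : ℕ} {r : ZMod N} (h : T.IsEqn s r) : T.IsVar s r := by
  have h1 := T.gen_add (r + s)
  rw [add_right_comm] at h1
  unfold IsEqn at h
  unfold IsVar
  omega

theorem IsEqn.isVar_add {s : ℕ} {r : ZMod N} (h : T.IsEqn s r) : T.IsVar s (r + M) := by
  have h1 := T.gen_add r
  unfold IsEqn at h
  unfold IsVar
  omega

theorem not_isVar_zero (r : ZMod N) : ¬ T.IsVar 0 r := by simp [IsVar]

theorem not_isEqn_zero (r : ZMod N) : ¬ T.IsEqn 0 r := fun h => not_isVar_zero r h.isVar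

theorem IsEqn.isVar_of_not_one {w : ℕ} {r : ZMod N} (h : T.IsEqn (w + 1) r) (h1 : ¬ T.IsEqn 1 r) :
    T.IsVar w (r + M + 1) := by
  have e : r + (M : ZMod N) + ((w + 1 : ℕ) : ZMod N) = r + M + 1 + w := by push_cast; ring
  unfold IsEqn at h h1
  rw [e] at h
  push_cast at h1
  unfold IsVar
  omega

theorem not_susp_one (j : ZMod d) : ¬ T.Susp 1 j := by
  intro h
  obtain ⟨r, hr, h1⟩ := T.admissible j
  have := h r hr
  unfold IsEqn at this
  push_cast at this
  omega

theorem exists_isVar_of_susp {w : ℕ} {j : ZMod d} (h : T.Susp (w + 1) j) :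
    ∃ r, T.cl r = j + 1 ∧ T.IsVar w r := by
  obtain ⟨r, hr, h1⟩ := T.admissible j
  refine ⟨r + M + 1, by rw [cl_add_M_add_one]; exact congrArg (· + 1) hr,
    (h r hr).isVar_of_not_one ?_⟩
  unfold IsEqn
  push_cast
  omega

/-- No weight is suspicious for all classes: otherwise translation by `M + s` would strictly
increase the sum of all the generators. -/
theorem exists_not_susp [NeZero N] (s : ℕ) : ∃ j, ¬ T.Susp s j := by
  by_contra! h
  have h1 : ∑ r, T.gen r < ∑ r, T.gen (r + (M + s)) := by
    refine Finset.sum_lt_sum_of_nonempty Finset.univ_nonempty fun r _ => ?_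
    have := h (T.cl r) r rfl
    unfold IsEqn at this
    rw [← add_assoc]
    omega
  exact h1.ne (Equiv.sum_comp (Equiv.addRight ((M : ZMod N) + s)) T.gen).symm

section Sums

variable [NeZero N] {A : Type*} [AddCommMonoid A]

open Classical in
theorem sum_cl_add_M (φ : ZMod N → A) (j : ZMod d) :
    ∑ r with T.cl r = j, φ (r + M) = ∑ r with T.cl r = j, φ r := by
  rw [Finset.sum_filter, Finset.sum_filter,
    ← Equiv.sum_comp (Equiv.addRight (M : ZMod N)) (fun r => if T.cl r = j then φ r else 0)]
  simp [cl_add_M]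

end Sums

variable (T) in
/-- A system of independent equations of weight `s`: if a class is suspicious, the equation at its
base point `base j` follows from the others and from their sum. -/
def IsTreeEqn (base : ZMod d → ZMod N) (s : ℕ) (r : ZMod N) : Prop :=
  T.IsEqn s r ∧ ¬ (T.Susp s (T.cl r) ∧ r = base (T.cl r))

variable {base : ZMod d → ZMod N}

theorem exists_not_isTreeEqn (hbase : ∀ j, T.cl (base j) = j) (s : ℕ) (r : ZMod N) :
    ∃ i : ℕ, ¬ T.IsTreeEqn base s (r + i * M) := by
  by_cases h : T.Susp s (T.cl r)
  · obtain ⟨i, hi⟩ := T.exists_eq_add r (base (T.cl r)) (hbase (T.cl r)).symm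
    refine ⟨i, fun h1 => h1.2 ?_⟩
    rw [cl_add_mul]
    exact ⟨h, hi.symm⟩
  · unfold Susp at h
    push Not at h
    obtain ⟨r', hr', h1⟩ := h
    obtain ⟨i, hi⟩ := T.exists_eq_add r r' hr'.symm
    exact ⟨i, fun h2 => h1 (hi ▸ h2.1)⟩

/-- Induction along the path `r, r + M, r + 2M, …`, up to its first point without an equation. -/
theorem tree_induction (hbase : ∀ j, T.cl (base j) = j) (s : ℕ) {P : ZMod N → Prop}
    (h0 : ∀ r, ¬ T.IsTreeEqn base s r → P r)
    (h1 : ∀ r, T.IsTreeEqn base s r → P (r + M) → P r) (r : ZMod N) : P r := by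
  obtain ⟨i, hi⟩ := exists_not_isTreeEqn hbase s r
  induction i generalizing r with
  | zero => exact h0 r (by simpa using hi)
  | succ i ih =>
    by_cases h : T.IsTreeEqn base s r
    · refine h1 r h (ih _ ?_)
      have e : r + (M : ZMod N) + i * M = r + ((i + 1 : ℕ) : ZMod N) * M := by push_cast; ring
      rwa [e]
    · exact h0 r h

/-- Every path through a free coefficient ends in a free coefficient without an equation. -/
theorem exists_root (hbase : ∀ j, T.cl (base j) = j) {w : ℕ} {j : ZMod d}
    (h : T.Susp (w + 1) (j - 1)) : ∃ r, T.cl r = j ∧ T.IsVar w r ∧ ¬ T.IsTreeEqn base w r := by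
  obtain ⟨r, hr, hv⟩ := exists_isVar_of_susp h
  rw [sub_add_cancel] at hr
  revert hr hv
  refine tree_induction hbase w (P := fun r => T.cl r = j → T.IsVar w r →
    ∃ r, T.cl r = j ∧ T.IsVar w r ∧ ¬ T.IsTreeEqn base w r) (fun r h hr hv => ⟨r, hr, hv, h⟩) ?_ r
  intro r h ih hr _
  exact ih (by rw [cl_add_M, hr]) h.1.isVar_add

/-- The difference equations `u r - u (r + M) = p r` on a path have a unique solution with given
values at the ends of the paths. -/
theorem exists_tree_solution {A : Type*} [AddCommGroup A] (hbase : ∀ j, T.cl (base j) = j) (s : ℕ)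
    (p v : ZMod N → A) :
    ∃ u : ZMod N → A, (∀ r, T.IsTreeEqn base s r → u r - u (r + M) = p r) ∧
      ∀ r, ¬ T.IsTreeEqn base s r → u r = v r := by
  classical
  -- `δ r` is the number of steps from `r` to the end of its path
  let δ r := Nat.find (exists_not_isTreeEqn hbase s r)
  have hδ r (h : T.IsTreeEqn base s r) : δ r = δ (r + M) + 1 := by
    have e (i : ℕ) : r + (M : ZMod N) + i * M = r + ((i + 1 : ℕ) : ZMod N) * M := by
      push_cast; ring
    have := Nat.find_comp_succ (exists_not_isTreeEqn hbase s r)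
      ((exists_not_isTreeEqn hbase s (r + M)).imp fun i hi => by rwa [e] at hi) (by simpa using h)
    simp only [δ, this, e]
  have hδ0 r (h : ¬ T.IsTreeEqn base s r) : δ r = 0 := by
    simp only [δ, Nat.find_eq_zero]
    simpa using h
  refine ⟨fun r => v (r + δ r * M) + ∑ i ∈ Finset.range (δ r), p (r + i * M), fun r h => ?_,
    fun r h => by simp [hδ0 r h]⟩
  have e (i : ℕ) : r + (M : ZMod N) + i * M = r + ((i + 1 : ℕ) : ZMod N) * M := by push_cast; ring
  simp only [hδ r h, Finset.sum_range_succ', e]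
  simp

open Classical in
theorem exists_eqn_solution [NeZero N] {A : Type*} [AddCommGroup A]
    (hbase : ∀ j, T.cl (base j) = j) (s : ℕ) (p v : ZMod N → A)
    (hp : ∀ j, T.Susp s j → ∑ r with T.cl r = j, p r = 0) (hv : ∀ r, ¬ T.IsVar s r → v r = 0) :
    ∃ u : ZMod N → A, (∀ r, ¬ T.IsVar s r → u r = 0) ∧
      (∀ r, T.IsEqn s r → u r - u (r + M) = p r) ∧
      ∀ r, ¬ T.IsTreeEqn base s r → u r = v r := by
  obtain ⟨u, h1, h2⟩ := exists_tree_solution hbase s p v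
  refine ⟨u, fun r h => ?_, fun r h => ?_, h2⟩
  · rw [h2 r fun h' => h h'.1.isVar, hv r h]
  · by_cases ht : T.IsTreeEqn base s r
    · exact h1 r ht
    · have hs : T.Susp s (T.cl r) ∧ r = base (T.cl r) := by
        by_contra hs
        exact ht ⟨h, hs⟩
      have h3 : ∑ r' with T.cl r' = T.cl r, (u r' - u (r' + M) - p r') = 0 := by
        rw [Finset.sum_sub_distrib, Finset.sum_sub_distrib, sum_cl_add_M, hp _ hs.1]
        simp
      rw [Finset.sum_eq_single_of_mem r (by simp)] at h3
      · exact sub_eq_zero.1 h3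
      · intro r' hr' hne
        rw [Finset.mem_filter] at hr'
        refine sub_eq_zero.2 (h1 r' ⟨hs.1 r' hr'.2, fun h' => hne ?_⟩)
        rw [h'.2, hr'.2]
        exact hs.2.symm

end Staircase

/-! ### The equations and their weights -/

namespace Staircase

variable {N d M : ℕ} {T : Staircase N d M}

section Solutions

variable {R : Type*} [CommRing R]

open Classical in
variable (T) in
/-- The coefficients of the expansion of `y f_r` in the basis, as determined recursively by the
coefficients `g` of the basis: the one belonging to the exponent `gen r + M + s` is put equal to `0`
if this exponent is a gap, and otherwise makes the coefficient of this exponent correct. -/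
noncomputable def quot (y : ℕ → R) (g : ℕ → ZMod N → R) (s : ℕ) (r : ZMod N) : R :=
  if T.IsEqn s r then 0 else
    ∑ p ∈ antidiagonal s, y p.1 * g p.2 r -
      ∑ i : Fin s, quot y g i r * g (s - i) (r + M + (i : ℕ))
termination_by s
decreasing_by exact i.2

variable (T) in
/-- What is left of `y f_r` in degree `gen r + M + s` when the basis elements of lower order are
subtracted with the coefficients `quot`. -/
noncomputable def residual (y : ℕ → R) (g : ℕ → ZMod N → R) (s : ℕ) (r : ZMod N) : R :=
  ∑ p ∈ antidiagonal s, y p.1 * g p.2 r -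
    ∑ i ∈ Finset.range s, T.quot y g i r * g (s - i) (r + M + (i : ℕ))

variable (T) in
/-- The part of the residual in weight `w + 1` that involves only coefficients of weight at most
`w`. -/
noncomputable def low (y : ℕ → R) (g : ℕ → ZMod N → R) (w : ℕ) (r : ZMod N) : R :=
  ∑ p ∈ antidiagonal w, y (p.1 + 1) * g p.2 r -
    ∑ i ∈ Finset.range w, T.quot y g (i + 1) r * g (w - i) (r + M + ((i + 1 : ℕ) : ZMod N))

variable (T) in
/-- The equations saying that the elements `f_r = t ^ gen r * ∑ l, g l r * t ^ l` span a submodule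
of the given type that is stable under multiplication by `t ^ M * ∑ i, y i * t ^ i`; the family `c`
consists of the coefficients of the products of this series with the `f_r`. -/
structure IsSolution (y : ℕ → R) (g : ℕ → ZMod N → R) : Prop where
  zero : ∀ r, g 0 r = 1
  eq_zero : ∀ s ≠ 0, ∀ r, ¬ T.IsVar s r → g s r = 0
  exists_quot : ∃ c : ℕ → ZMod N → R, (∀ s r, T.IsEqn s r → c s r = 0) ∧
    ∀ s r, ∑ p ∈ antidiagonal s, y p.1 * g p.2 r =
      ∑ p ∈ antidiagonal s, c p.1 r * g p.2 (r + M + (p.1 : ℕ))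

variable {y : ℕ → R} {g g' : ℕ → ZMod N → R}

theorem quot_of_isEqn {s : ℕ} {r : ZMod N} (h : T.IsEqn s r) : T.quot y g s r = 0 := by
  rw [quot, if_pos h]

theorem quot_of_not_isEqn {s : ℕ} {r : ZMod N} (h : ¬ T.IsEqn s r) :
    T.quot y g s r = T.residual y g s r := by
  rw [quot, if_neg h, residual, Finset.sum_range]

theorem quot_zero (hy : y 0 = 1) (hg : ∀ r, g 0 r = 1) (r : ZMod N) : T.quot y g 0 r = 1 := by
  rw [quot_of_not_isEqn (not_isEqn_zero r)]
  simp [residual, hy, hg]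

theorem residual_succ (hy : y 0 = 1) (hg : ∀ r, g 0 r = 1) (w : ℕ) (r : ZMod N) :
    T.residual y g (w + 1) r = g (w + 1) r - g (w + 1) (r + M) + T.low y g w r := by
  rw [residual, Finset.Nat.sum_antidiagonal_succ, Finset.sum_range_succ', low, quot_zero hy hg, hy]
  simp only [Nat.add_sub_add_right]
  simp
  ring

theorem low_zero (hg : ∀ r, g 0 r = 1) (r : ZMod N) : T.low y g 0 r = y 1 := by
  simp [low, hg]

theorem sum_antidiagonal_eq_range_add (hg : ∀ r, g 0 r = 1) (c : ℕ → ZMod N → R) (s : ℕ)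
    (r : ZMod N) :
    ∑ p ∈ antidiagonal s, c p.1 r * g p.2 (r + M + (p.1 : ℕ)) =
      ∑ i ∈ Finset.range s, c i r * g (s - i) (r + M + (i : ℕ)) + c s r := by
  rw [Finset.Nat.sum_antidiagonal_eq_sum_range_succ (fun i l => c i r * g l (r + M + (i : ℕ))),
    Finset.sum_range_succ, Nat.sub_self, hg, mul_one]

theorem isSolution_iff : T.IsSolution y g ↔ (∀ r, g 0 r = 1) ∧
    (∀ s ≠ 0, ∀ r, ¬ T.IsVar s r → g s r = 0) ∧
      ∀ s r, T.IsEqn s r → T.residual y g s r = 0 := by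
  constructor
  · rintro ⟨h0, h1, c, h2, h3⟩
    have key : ∀ s r, T.quot y g s r = c s r ∧ T.residual y g s r = c s r := by
      intro s r
      induction s using Nat.strong_induction_on with
      | _ s ih =>
        have e : T.residual y g s r = c s r := by
          rw [residual, h3, sum_antidiagonal_eq_range_add h0]
          rw [Finset.sum_congr rfl fun i hi =>
            congrArg (· * _) (ih i (Finset.mem_range.1 hi)).1, add_sub_cancel_left]
        refine ⟨?_, e⟩
        by_cases h : T.IsEqn s r
        · rw [quot_of_isEqn h, h2 s r h]
        · rw [quot_of_not_isEqn h, e]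
    exact ⟨h0, h1, fun s r h => by rw [(key s r).2, h2 s r h]⟩
  · rintro ⟨h0, h1, h2⟩
    refine ⟨h0, h1, T.quot y g, fun s r => quot_of_isEqn, fun s r => ?_⟩
    have e : T.quot y g s r = T.residual y g s r := by
      by_cases h : T.IsEqn s r
      · rw [quot_of_isEqn h, h2 s r h]
      · exact quot_of_not_isEqn h
    rw [sum_antidiagonal_eq_range_add h0, e, residual]
    ring

theorem quot_congr {s : ℕ} {r : ZMod N} (h : ∀ i < s, g i = g' i) (hr : g s r = g' s r)
    (hr' : g s (r + M) = g' s (r + M)) (i : ℕ) (hi : i ≤ s) :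
    T.quot y g i r = T.quot y g' i r := by
  have h1 : ∀ i ≤ s, g i r = g' i r := fun i hi => by
    rcases hi.eq_or_lt with rfl | hi
    exacts [hr, by rw [h i hi]]
  induction i using Nat.strong_induction_on with
  | _ i ih =>
    by_cases he : T.IsEqn i r
    · rw [quot_of_isEqn he, quot_of_isEqn he]
    rw [quot_of_not_isEqn he, quot_of_not_isEqn he, residual, residual]
    congr 1
    · refine Finset.sum_congr rfl fun p hp => ?_
      rw [h1 p.2 ((Finset.HasAntidiagonal.antidiagonal.snd_le hp).trans hi)]
    · refine Finset.sum_congr rfl fun k hk => ?_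
      rw [Finset.mem_range] at hk
      rw [ih k hk (hk.le.trans hi)]
      congr 1
      rcases (show i - k ≤ s by omega).eq_or_lt with e | e
      · obtain rfl : k = 0 := by omega
        rw [e]
        simpa using hr'
      · rw [h _ e]

theorem low_congr {w : ℕ} (h : ∀ i ≤ w, g i = g' i) (r : ZMod N) :
    T.low y g w r = T.low y g' w r := by
  have hq i (hi : i ≤ w) : T.quot y g i r = T.quot y g' i r :=
    quot_congr (fun i hi => h i hi.le) (by rw [h w le_rfl]) (by rw [h w le_rfl]) i hi
  rw [low, low]
  congr 1
  · exact Finset.sum_congr rfl fun p hp => by rw [h _ (Finset.HasAntidiagonal.antidiagonal.snd_le hp)]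
  · refine Finset.sum_congr rfl fun i hi => ?_
    rw [Finset.mem_range] at hi
    rw [hq _ (by omega), h _ (Nat.sub_le _ _)]

theorem residual_congr {s : ℕ} (h : ∀ i ≤ s, g i = g' i) (r : ZMod N) :
    T.residual y g s r = T.residual y g' s r := by
  rw [residual, residual]
  congr 1
  · exact Finset.sum_congr rfl fun p hp => by rw [h _ (Finset.HasAntidiagonal.antidiagonal.snd_le hp)]
  · refine Finset.sum_congr rfl fun i hi => ?_
    rw [Finset.mem_range] at hi
    rw [h _ (Nat.sub_le _ _), quot_congr (s := i) (fun k hk => h k (by omega)) (by rw [h i hi.le])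
      (by rw [h i hi.le]) i le_rfl]

/-- Among the coefficients of weight `w`, those in the class of `r` and the single one at
`r + M + 1` enter into `low y g w r`, the latter linearly. -/
theorem low_sub {w : ℕ} (hw : w ≠ 0) {r : ZMod N} (h : ∀ i < w, g i = g' i)
    (hr : g w r = g' w r) (hr' : g w (r + M) = g' w (r + M)) :
    T.low y g w r - T.low y g' w r =
      - (T.quot y g 1 r * (g w (r + M + 1) - g' w (r + M + 1))) := by
  obtain ⟨w, rfl⟩ := Nat.exists_eq_succ_of_ne_zero hw
  have hq i (hi : i ≤ w + 1) : T.quot y g i r = T.quot y g' i r := quot_congr h hr hr' i hi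
  have e1 : ∑ p ∈ antidiagonal (w + 1), y (p.1 + 1) * g p.2 r =
      ∑ p ∈ antidiagonal (w + 1), y (p.1 + 1) * g' p.2 r := by
    refine Finset.sum_congr rfl fun p hp => ?_
    rcases (Finset.HasAntidiagonal.antidiagonal.snd_le hp).eq_or_lt with e | e
    · rw [e, hr]
    · rw [h _ e]
  have e2 : ∑ i ∈ Finset.range w, T.quot y g (i + 1 + 1) r *
        g (w + 1 - (i + 1)) (r + M + ((i + 1 + 1 : ℕ) : ZMod N)) =
      ∑ i ∈ Finset.range w, T.quot y g' (i + 1 + 1) r *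
        g' (w + 1 - (i + 1)) (r + M + ((i + 1 + 1 : ℕ) : ZMod N)) := by
    refine Finset.sum_congr rfl fun i hi => ?_
    rw [Finset.mem_range] at hi
    rw [hq _ (by omega), h _ (by omega)]
  simp only [Nat.succ_eq_add_one] at *
  rw [low, low, Finset.sum_range_succ', Finset.sum_range_succ', e1, e2, hq 1 (by omega)]
  simp
  ring

variable [NeZero N]

open Classical in
theorem sum_residual (hy : y 0 = 1) (hg : ∀ r, g 0 r = 1) (w : ℕ) (j : ZMod d) :
    ∑ r with T.cl r = j, T.residual y g (w + 1) r = ∑ r with T.cl r = j, T.low y g w r := by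
  simp only [residual_succ hy hg, Finset.sum_add_distrib, Finset.sum_sub_distrib]
  rw [sum_cl_add_M (fun r => g (w + 1) r)]
  simp

open Classical in
/-- The key computation: in the sum of the equations of weight `w + 1` over a suspicious class `j`,
the coefficient of a common shift of the coefficients of weight `w` in the class `j + 1` is, up to
sign, the sum of the coefficient `y 1` over the class `j`. -/
theorem sum_low_sub (hy : y 0 = 1) {w : ℕ} (hw : w ≠ 0) {j : ZMod d} (hj : T.Susp (w + 1) j) (k : R)
    (hg : ∀ r, g 0 r = 1) (h : ∀ i < w, g i = g' i)
    (h1 : ∀ r, T.IsEqn 1 r → T.residual y g 1 r = 0)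
    (hr : ∀ r, T.cl r = j → g w r = g' w r)
    (hr' : ∀ r, T.cl r = j + 1 → T.IsVar w r → g w r - g' w r = k) :
    ∑ r with T.cl r = j, T.low y g w r - ∑ r with T.cl r = j, T.low y g' w r =
      - (k * ∑ r with T.cl r = j, y 1) := by
  have h2 : ∑ r with T.cl r = j, T.quot y g 1 r = ∑ r with T.cl r = j, y 1 := by
    have := sum_residual (T := T) hy hg 0 j
    simp only [low_zero hg, zero_add] at this
    rw [← this]
    refine Finset.sum_congr rfl fun r _ => ?_
    by_cases he : T.IsEqn 1 r
    · rw [quot_of_isEqn he, h1 r he]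
    · exact quot_of_not_isEqn he
  rw [← h2, ← Finset.sum_sub_distrib, Finset.mul_sum, ← Finset.sum_neg_distrib]
  refine Finset.sum_congr rfl fun r hr0 => ?_
  rw [Finset.mem_filter] at hr0
  rw [low_sub hw h (hr r hr0.2) (hr _ (by rw [cl_add_M, hr0.2]))]
  by_cases he : T.IsEqn 1 r
  · simp [quot_of_isEqn he]
  · rw [hr' _ (by rw [cl_add_M_add_one, hr0.2]) ((hj r hr0.2).isVar_of_not_one he), mul_comm]

end Solutions

variable (T) in
/-- A choice of a base point in each class, and of the end of a path in each class `j` whose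
coefficients of weight `w` are subject to the sum of the equations of weight `w + 1` over the
preceding class. -/
structure Pivots where
  base : ZMod d → ZMod N
  cl_base : ∀ j, T.cl (base j) = j
  root : ℕ → ZMod d → ZMod N
  root_spec : ∀ w j, T.Susp (w + 1) (j - 1) →
    T.cl (root w j) = j ∧ T.IsVar w (root w j) ∧ ¬ T.IsTreeEqn base w (root w j)

variable (T) in
theorem nonempty_pivots [NeZero N] : Nonempty (Pivots T) := by
  have hb (j : ZMod d) : ∃ r, T.cl r = j := by
    obtain ⟨r, hr, -⟩ := T.admissible j
    exact ⟨r, hr⟩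
  choose base hbase using hb
  have hr (w : ℕ) (j : ZMod d) : ∃ r, T.Susp (w + 1) (j - 1) →
      T.cl r = j ∧ T.IsVar w r ∧ ¬ T.IsTreeEqn base w r := by
    by_cases h : T.Susp (w + 1) (j - 1)
    · obtain ⟨r, hr⟩ := exists_root hbase h
      exact ⟨r, fun _ => hr⟩
    · exact ⟨0, fun h' => absurd h' h⟩
  choose root hroot using hr
  exact ⟨⟨base, hbase, root, hroot⟩⟩

variable (P : Pivots T)

/-- The indices (weight and residue) of the free coordinates on the set of solutions: the ends of
the paths, except the chosen one in each class with an additional equation. -/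
def freeIndices : Set (ℕ × ZMod N) :=
  {p | T.IsVar p.1 p.2 ∧ ¬ T.IsTreeEqn P.base p.1 p.2 ∧
    ¬ (T.Susp (p.1 + 1) (T.cl p.2 - 1) ∧ p.2 = P.root p.1 (T.cl p.2))}

open Classical in
/-- The free coordinates: coefficients at the ends of the paths, in a class with an additional
equation relative to the coefficient at the chosen end. -/
noncomputable def coord {R : Type*} [CommRing R] (g : ℕ → ZMod N → R) (p : ℕ × ZMod N) : R :=
  g p.1 p.2 - if T.Susp (p.1 + 1) (T.cl p.2 - 1) then g p.1 (P.root p.1 (T.cl p.2)) else 0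

variable {R : Type*} [CommRing R] {y : ℕ → R} {P} [NeZero N]

open Classical in
/-- A solution is determined by its free coordinates. -/
theorem IsSolution.ext_coord (hy : y 0 = 1) (hy1 : ∀ j, IsUnit (∑ r with T.cl r = j, y 1))
    {g g' : ℕ → ZMod N → R} (hg : T.IsSolution y g) (hg' : T.IsSolution y g')
    (h : ∀ p ∈ freeIndices P, coord P g p = coord P g' p) : g = g' := by
  have : NeZero d := ⟨fun h => NeZero.ne N (Nat.eq_zero_of_zero_dvd (h ▸ T.dvd_N))⟩
  rw [isSolution_iff] at hg hg'
  obtain ⟨h0, h1, h2⟩ := hg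
  obtain ⟨h0', h1', h2'⟩ := hg'
  funext w
  induction w using Nat.strong_induction_on with
  | _ w ih =>
    rcases eq_or_ne w 0 with rfl | hw
    · funext r
      rw [h0, h0']
    -- the difference of the two solutions is constant along the paths
    have htree : ∀ r, T.IsTreeEqn P.base w r →
        g w r - g' w r = g w (r + M) - g' w (r + M) := by
      intro r hr
      obtain ⟨w, rfl⟩ := Nat.exists_eq_succ_of_ne_zero hw
      have e1 := h2 _ r hr.1
      have e2 := h2' _ r hr.1
      rw [Nat.succ_eq_add_one, residual_succ hy h0] at e1
      rw [Nat.succ_eq_add_one, residual_succ hy h0'] at e2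
      rw [low_congr (g' := g') (fun i hi => ih i (by omega))] at e1
      linear_combination e1 - e2
    have hconst (j : ZMod d) (k : R) (hk : ∀ r, T.cl r = j → T.IsVar w r →
        ¬ T.IsTreeEqn P.base w r → g w r - g' w r = k) :
        ∀ r, T.cl r = j → T.IsVar w r → g w r - g' w r = k := by
      refine tree_induction P.cl_base w (fun r hr hj hv => hk r hj hv hr) fun r hr ih hj hv => ?_
      rw [htree r hr]
      exact ih (by rw [cl_add_M, hj]) hr.1.isVar_add
    have hclass (j : ZMod d) (hj : T.Susp (w + 1) (j - 1) → ∀ r, T.cl r = j - 1 →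
        g w r = g' w r) : ∀ r, T.cl r = j → g w r = g' w r := by
      intro r hr
      by_cases hv : T.IsVar w r
      swap
      · rw [h1 w hw r hv, h1' w hw r hv]
      rw [← sub_eq_zero]
      by_cases hs : T.Susp (w + 1) (j - 1)
      · set k := g w (P.root w j) - g' w (P.root w j) with hkdef
        have hk := hconst j k (by
          intro r hr hv ht
          by_cases hroot : r = P.root w j
          · rw [hroot]
          · have := h (w, r) ⟨hv, ht, fun h => hroot (by simpa [hr] using h.2)⟩
            simp only [coord, hr, hs, if_true] at this
            linear_combination this)
        rw [hk r hr hv]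
        have e := sum_low_sub hy hw hs k h0 ih (h2 1) (hj hs) (by
          intro r hr
          exact hk r (by rw [hr, sub_add_cancel]))
        have e1 : ∑ r with T.cl r = j - 1, T.low y g w r = 0 := by
          rw [← sum_residual hy h0]
          exact Finset.sum_eq_zero fun r hr => h2 _ _ (hs r (Finset.mem_filter.1 hr).2)
        have e2 : ∑ r with T.cl r = j - 1, T.low y g' w r = 0 := by
          rw [← sum_residual hy h0']
          exact Finset.sum_eq_zero fun r hr => h2' _ _ (hs r (Finset.mem_filter.1 hr).2)
        rw [e1, e2, sub_zero, zero_eq_neg] at e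
        exact (hy1 (j - 1)).mul_left_eq_zero.1 e
      · refine hconst j 0 (fun r hr hv ht => ?_) r hr hv
        have := h (w, r) ⟨hv, ht, fun h => hs (by simpa [hr] using h.1)⟩
        simp only [coord, hr, hs, if_false] at this
        linear_combination this
    obtain ⟨j0, hj0⟩ := T.exists_not_susp (w + 1)
    have hall (q : ℕ) : ∀ r, T.cl r = j0 + 1 + q → g w r = g' w r := by
      induction q with
      | zero =>
        refine hclass _ fun hs => absurd ?_ hj0
        simpa using hs
      | succ q ihq =>
        refine hclass _ fun hs r hr => ihq r ?_
        rw [hr]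
        push_cast
        ring
    funext r
    refine hall (T.cl r - j0 - 1).val r ?_
    rw [ZMod.natCast_zmod_val]
    ring

end Staircase

/-! ### Solving the equations, and the number of free coordinates -/

namespace Staircase

variable {N d M : ℕ} {T : Staircase N d M} {P : Pivots T} {R : Type*} [CommRing R] {y : ℕ → R}

variable (P) in
/-- A solution of the equations of weight at most `w` with prescribed free coordinates. -/
structure IsPartialSolution (y : ℕ → R) (v : ℕ × ZMod N → R) (w : ℕ) (g : ℕ → ZMod N → R) :
    Prop where
  zero : ∀ r, g 0 r = 1
  eq_zero : ∀ s ≠ 0, ∀ r, ¬ T.IsVar s r → g s r = 0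
  residual_eq_zero : ∀ s ≤ w, ∀ r, T.IsEqn s r → T.residual y g s r = 0
  coord_eq : ∀ p ∈ freeIndices P, p.1 ≤ w → coord P g p = v p

theorem coord_congr {g g' : ℕ → ZMod N → R} (p : ℕ × ZMod N) (h : g p.1 = g' p.1) :
    coord P g p = coord P g' p := by
  simp only [coord, h]

open Classical in
/-- In a class with an additional equation a common shift of the coefficients of weight `w`
preserves the equations of weight `w` and the free coordinates. -/
theorem IsPartialSolution.exists_shift (hy : y 0 = 1) {v : ℕ × ZMod N → R} {w : ℕ}
    {g : ℕ → ZMod N → R} (hg : IsPartialSolution P y v (w + 1) g) {j : ZMod d}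
    (hj : T.Susp (w + 2) j) (h : R) :
    ∃ g', IsPartialSolution P y v (w + 1) g' ∧ (∀ i < w + 1, g' i = g i) ∧
      ∀ r, g' (w + 1) r = g (w + 1) r + if T.cl r = j + 1 ∧ T.IsVar (w + 1) r then h else 0 := by
  set g' := Function.update g (w + 1)
    (fun r => g (w + 1) r + if T.cl r = j + 1 ∧ T.IsVar (w + 1) r then h else 0) with hg'
  have h1 : ∀ i, i ≠ w + 1 → g' i = g i := fun i hi => by simp [hg', hi]
  have h2 : ∀ r, g' (w + 1) r =
      g (w + 1) r + if T.cl r = j + 1 ∧ T.IsVar (w + 1) r then h else 0 := by simp [hg']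
  refine ⟨g', ⟨fun r => ?_, fun s hs r hr => ?_, fun s hs r hr => ?_, fun p hp hpw => ?_⟩,
    fun i hi => h1 i hi.ne, h2⟩
  · rw [h1 0 (by omega), hg.zero]
  · by_cases e : s = w + 1
    · subst e
      rw [h2, hg.eq_zero _ hs r hr, if_neg fun h => hr h.2, add_zero]
    · rw [h1 s e, hg.eq_zero s hs r hr]
  · by_cases e : s = w + 1
    · subst e
      have e1 := hg.residual_eq_zero _ le_rfl r hr
      have h0 : ∀ r, g' 0 r = 1 := fun r => by rw [h1 0 (by omega), hg.zero]
      rw [residual_succ hy hg.zero] at e1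
      rw [residual_succ hy h0, low_congr (g' := g) (fun i hi => h1 i (by omega)), h2, h2, cl_add_M]
      have e2 : T.IsVar (w + 1) r ↔ T.IsVar (w + 1) (r + M) :=
        ⟨fun _ => hr.isVar_add, fun _ => hr.isVar⟩
      rw [← e2]
      linear_combination e1
    · rw [residual_congr (g' := g) (fun i hi => h1 i (by omega)), hg.residual_eq_zero s hs r hr]
  · rw [← hg.coord_eq p hp hpw]
    by_cases e : p.1 = w + 1
    · simp only [coord, e, h2]
      by_cases hs : T.Susp (w + 1 + 1) (T.cl p.2 - 1)
      · obtain ⟨r1, r2, -⟩ := P.root_spec _ _ hs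
        have hv : T.IsVar (w + 1) p.2 := e ▸ hp.1
        simp only [hs, if_true, r1, r2, hv]
        ring
      · have hne : T.cl p.2 ≠ j + 1 := fun h => hs (by rw [h, add_sub_cancel_right]; exact hj)
        simp [hs, hne]
    · exact coord_congr p (h1 _ e)

variable [NeZero N]

open Classical in
/-- The step of the elimination: the coefficients of weight `w + 1` are found class by class,
beginning after a class that is not suspicious. -/
theorem IsPartialSolution.exists_succ (hy : y 0 = 1)
    (hy1 : ∀ j, IsUnit (∑ r with T.cl r = j, y 1)) {v : ℕ × ZMod N → R} {w : ℕ}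
    {g : ℕ → ZMod N → R} (hg : IsPartialSolution P y v w g)
    (hsum : ∀ j, T.Susp (w + 1) j → ∑ r with T.cl r = j, T.low y g w r = 0) :
    ∃ g', IsPartialSolution P y v (w + 1) g' ∧
      ∀ j, T.Susp (w + 2) j → ∑ r with T.cl r = j, T.low y g' (w + 1) r = 0 := by
  have : NeZero d := ⟨fun h => NeZero.ne N (Nat.eq_zero_of_zero_dvd (h ▸ T.dvd_N))⟩
  obtain ⟨j0, hj0⟩ := T.exists_not_susp (w + 2)
  have key (q : ℕ) (hq : q ≤ d) : ∃ g', IsPartialSolution P y v (w + 1) g' ∧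
      ∀ i < q, T.Susp (w + 2) (j0 + (i : ℕ)) →
        ∑ r with T.cl r = j0 + (i : ℕ), T.low y g' (w + 1) r = 0 := by
    induction q with
    | zero =>
      obtain ⟨u, hu0, hu1, hu2⟩ := exists_eqn_solution P.cl_base (w + 1)
        (fun r => - T.low y g w r) (fun r => if (w + 1, r) ∈ freeIndices P then v (w + 1, r) else 0)
        (fun j hj => by rw [Finset.sum_neg_distrib, hsum j hj, neg_zero])
        (fun r hr => if_neg fun h => hr h.1)
      set g' := Function.update g (w + 1) u with hg'
      have h1 : ∀ i, i ≠ w + 1 → g' i = g i := fun i hi => by simp [hg', hi]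
      have h2 : g' (w + 1) = u := by simp [hg']
      have h0 : ∀ r, g' 0 r = 1 := fun r => by rw [h1 0 (by omega), hg.zero]
      refine ⟨g', ⟨h0, fun s hs r hr => ?_, fun s hs r hr => ?_, fun p hp hpw => ?_⟩, by simp⟩
      · by_cases e : s = w + 1
        · subst e
          rw [h2, hu0 r hr]
        · rw [h1 s e, hg.eq_zero s hs r hr]
      · by_cases e : s = w + 1
        · subst e
          rw [residual_succ hy h0, low_congr (g' := g) (fun i hi => h1 i (by omega)), h2, hu1 r hr]
          ring
        · rw [residual_congr (g' := g) (fun i hi => h1 i (by omega)),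
            hg.residual_eq_zero s (by omega) r hr]
      · by_cases e : p.1 = w + 1
        · obtain ⟨p1, r⟩ := p
          simp only at e
          subst e
          simp only [coord, h2]
          rw [hu2 r hp.2.1, if_pos hp]
          by_cases hs : T.Susp (w + 1 + 1) (T.cl r - 1)
          · obtain ⟨r1, r2, r3⟩ := P.root_spec _ _ hs
            rw [if_pos hs, hu2 _ r3, if_neg fun h => h.2.2 (by simp [r1, hs]), sub_zero]
          · rw [if_neg hs, sub_zero]
        · rw [coord_congr p (h1 _ e), hg.coord_eq p hp (by omega)]
    | succ q ih =>
      obtain ⟨g1, hg1, hg2⟩ := ih (by omega)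
      by_cases hs : T.Susp (w + 2) (j0 + (q : ℕ))
      swap
      · refine ⟨g1, hg1, fun i hi hsi => ?_⟩
        rcases (Nat.lt_succ_iff.1 hi).eq_or_lt with rfl | hi
        · exact absurd hsi hs
        · exact hg2 i hi hsi
      -- the classes `j0, …, j0 + (q + 1)` are distinct, except that the last may be `j0`
      have hdist : ∀ a ≤ q, a ≠ 0 → (j0 + (a : ℕ) : ZMod d) ≠ j0 + (q : ℕ) + 1 := by
        intro a ha ha0 h
        rw [add_assoc, add_right_inj, ← Nat.cast_succ, ZMod.natCast_eq_natCast_iff'] at h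
        rcases (show q.succ ≤ d from hq).eq_or_lt with e | e
        · rw [e, Nat.mod_self, Nat.mod_eq_of_lt (by omega)] at h
          exact ha0 h
        · rw [Nat.mod_eq_of_lt e, Nat.mod_eq_of_lt (by omega)] at h
          omega
      have hq0 : q ≠ 0 := by
        rintro rfl
        exact hj0 (by simpa using hs)
      obtain ⟨U, hU⟩ := hy1 (j0 + (q : ℕ))
      obtain ⟨g2, hg3, hg4, hg5⟩ := hg1.exists_shift hy hs
        (↑U⁻¹ * ∑ r with T.cl r = j0 + (q : ℕ), T.low y g1 (w + 1) r)
      refine ⟨g2, hg3, fun i hi hsi => ?_⟩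
      have hi0 : i ≠ 0 := by
        rintro rfl
        exact hj0 (by simpa using hsi)
      have hagree : ∀ r, T.cl r = j0 + (i : ℕ) → g2 (w + 1) r = g1 (w + 1) r := by
        intro r hr
        rw [hg5, if_neg, add_zero]
        exact fun h => hdist i (by omega) hi0 (hr ▸ h.1)
      have h1 : ∀ r, T.IsEqn 1 r → T.residual y g2 1 r = 0 :=
        hg3.residual_eq_zero 1 (by omega)
      rcases (Nat.lt_succ_iff.1 hi).eq_or_lt with rfl | hi
      · have := sum_low_sub hy (Nat.succ_ne_zero w) hs _ hg3.zero hg4 h1 hagree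
          (fun r hr hv => by rw [hg5, if_pos ⟨hr, hv⟩, add_sub_cancel_left])
        rw [← hU, mul_right_comm, Units.inv_mul, one_mul] at this
        linear_combination this
      · have := sum_low_sub hy (Nat.succ_ne_zero w) hsi 0 hg3.zero hg4 h1 hagree
          (fun r hr hv => by
            rw [hg5, if_neg, add_zero, sub_self]
            refine fun h => hdist (i + 1) (by omega) (by omega) ?_
            rw [← h.1, hr]
            push_cast
            ring)
        rw [zero_mul, neg_zero, sub_eq_zero] at this
        rw [this, hg2 i hi hsi]
  obtain ⟨g', h1, h2⟩ := key d le_rfl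
  refine ⟨g', h1, fun j hj => ?_⟩
  have e : j = j0 + ((j - j0).val : ℕ) := by rw [ZMod.natCast_zmod_val]; ring
  rw [e] at hj ⊢
  exact h2 _ (ZMod.val_lt _) hj

variable (T) in
theorem exists_forall_not_isVar : ∃ W : ℕ, ∀ s > W, ∀ r, ¬ T.IsVar s r := by
  refine ⟨∑ r, T.gen r, fun s hs r h => ?_⟩
  have := Finset.single_le_sum (f := T.gen) (fun _ _ => Nat.zero_le _) (Finset.mem_univ (r + s))
  unfold IsVar at h
  omega

open Classical in
variable (P) in
/-- The free coordinates of a solution can be prescribed. -/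
theorem exists_solution (hy : y 0 = 1) (hy1 : ∀ j, IsUnit (∑ r with T.cl r = j, y 1))
    (v : ℕ × ZMod N → R) :
    ∃ g, T.IsSolution y g ∧ ∀ p ∈ freeIndices P, coord P g p = v p := by
  have key (w : ℕ) : ∃ g, IsPartialSolution P y v w g ∧
      ∀ j, T.Susp (w + 1) j → ∑ r with T.cl r = j, T.low y g w r = 0 := by
    induction w with
    | zero =>
      refine ⟨fun s _ => if s = 0 then 1 else 0, ⟨by simp, fun s hs => by simp [hs],
        fun s hs r hr => ?_, fun p hp hp0 => ?_⟩, fun j hj => absurd hj (not_susp_one j)⟩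
      · rw [Nat.le_zero.1 hs] at hr
        exact absurd hr (not_isEqn_zero r)
      · have := hp.1
        rw [Nat.le_zero.1 hp0] at this
        exact absurd this (not_isVar_zero _)
    | succ w ih =>
      obtain ⟨g, hg, hs⟩ := ih
      exact hg.exists_succ hy hy1 hs
  obtain ⟨W, hW⟩ := T.exists_forall_not_isVar
  obtain ⟨g, hg, -⟩ := key W
  refine ⟨g, isSolution_iff.2 ⟨hg.zero, hg.eq_zero, fun s r hr => ?_⟩, fun p hp => ?_⟩
  · exact hg.residual_eq_zero s (not_lt.1 fun h => hW s h r hr.isVar) r hr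
  · exact hg.coord_eq p hp (not_lt.1 fun h => hW _ h _ hp.1)

variable (P) in
theorem finite_freeIndices : (freeIndices P).Finite := by
  obtain ⟨W, hW⟩ := T.exists_forall_not_isVar
  refine ((Set.finite_Iic W).prod Set.finite_univ).subset fun p hp => ⟨?_, trivial⟩
  exact not_lt.1 fun h => hW _ h _ hp.1

open Classical in
variable (P) in
theorem card_freeIndices_weight (w : ℕ) :
    ((Finset.univ.filter fun r => (w, r) ∈ freeIndices P).card : ℤ) =
      (Finset.univ.filter fun r => T.IsVar w r).card -
      (Finset.univ.filter fun r => T.IsEqn w r).card +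
      Nat.card {j // T.Susp w j} - Nat.card {j // T.Susp (w + 1) j} := by
  have : NeZero d := ⟨fun h => NeZero.ne N (Nat.eq_zero_of_zero_dvd (h ▸ T.dvd_N))⟩
  have h1 : (Finset.univ.filter fun r => T.IsEqn w r) =
      (Finset.univ.filter fun r => T.IsTreeEqn P.base w r) ∪
        (Finset.univ.filter fun j => T.Susp w j).image P.base := by
    ext r
    simp only [Finset.mem_union, Finset.mem_filter, Finset.mem_univ, true_and, Finset.mem_image]
    constructor
    · intro h
      by_cases h' : T.IsTreeEqn P.base w r
      · exact Or.inl h'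
      · have : T.Susp w (T.cl r) ∧ r = P.base (T.cl r) := by
          by_contra hs
          exact h' ⟨h, hs⟩
        exact Or.inr ⟨_, this.1, this.2.symm⟩
    · rintro (h | ⟨j, hj, rfl⟩)
      exacts [h.1, hj _ (P.cl_base j)]
  have h2 : (Finset.univ.filter fun r => T.IsVar w r) =
      ((Finset.univ.filter fun r => T.IsTreeEqn P.base w r) ∪
        (Finset.univ.filter fun r => (w, r) ∈ freeIndices P)) ∪
        (Finset.univ.filter fun j => T.Susp (w + 1) j).image (fun j => P.root w (j + 1)) := by
    ext r
    simp only [Finset.mem_union, Finset.mem_filter, Finset.mem_univ, true_and, Finset.mem_image]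
    constructor
    · intro h
      by_cases h' : T.IsTreeEqn P.base w r
      · exact Or.inl (Or.inl h')
      · by_cases hs : T.Susp (w + 1) (T.cl r - 1) ∧ r = P.root w (T.cl r)
        · exact Or.inr ⟨_, hs.1, by rw [sub_add_cancel]; exact hs.2.symm⟩
        · exact Or.inl (Or.inr ⟨h, h', hs⟩)
    · rintro ((h | h) | ⟨j, hj, rfl⟩)
      · exact h.1.isVar
      · exact h.1
      · exact (P.root_spec w (j + 1) (by rwa [add_sub_cancel_right])).2.1
  have hroot {j} (hj : T.Susp (w + 1) j) := P.root_spec w (j + 1) (by rwa [add_sub_cancel_right])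
  rw [h1, h2, Finset.card_union_of_disjoint, Finset.card_union_of_disjoint,
    Finset.card_union_of_disjoint, Finset.card_image_of_injOn, Finset.card_image_of_injOn,
    Nat.card_eq_fintype_card, Nat.card_eq_fintype_card, Fintype.card_subtype, Fintype.card_subtype]
  · push_cast
    ring
  · intro a _ b _ h
    rw [← P.cl_base a, h, P.cl_base]
  · intro a ha b hb h
    simp only [Finset.coe_filter, Finset.mem_univ, true_and, Set.mem_ofPred_eq] at ha hb h
    have := (hroot ha).1
    rw [h, (hroot hb).1] at this
    exact (add_right_cancel this).symm
  · rw [Finset.disjoint_left]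
    simp only [Finset.mem_filter, Finset.mem_univ, true_and, Finset.mem_image, not_exists, not_and]
    rintro r hr j hj rfl
    exact hr.2 (by rw [P.cl_base]; exact ⟨hj, rfl⟩)
  · rw [Finset.disjoint_left]
    simp only [Finset.mem_filter, Finset.mem_univ, true_and]
    exact fun r hr h => h.2.1 hr
  · rw [Finset.disjoint_left]
    simp only [Finset.mem_filter, Finset.mem_univ, true_and, Finset.mem_image, not_exists, not_and,
      Finset.mem_union]
    rintro r hr j hj rfl
    obtain ⟨r1, r2, r3⟩ := hroot hj
    rcases hr with hr | hr
    · exact r3 hr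
    · exact hr.2.2 (by simp only; rw [r1, add_sub_cancel_right]; exact ⟨hj, rfl⟩)

variable (P) in
/-- The number of free coordinates is the number of variables minus the number of equations: the
equations that are dependent in weight `w` are made up for by additional ones on the coefficients
of weight `w - 1`, and there is none of weight `1`. -/
theorem card_freeIndices : (Nat.card (freeIndices P) : ℤ) =
    ∑ r, ((Nat.card {s // T.IsVar s r} : ℤ) - Nat.card {s // T.IsEqn s r}) := by
  classical
  obtain ⟨W, hW⟩ := T.exists_forall_not_isVar
  have hcard (Q : ℕ → Prop) (hQ : ∀ s > W, ¬ Q s) :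
      (Nat.card {s // Q s} : ℤ) = ∑ s ∈ Finset.range (W + 1), if Q s then 1 else 0 := by
    rw [Nat.subtype_card ((Finset.range (W + 1)).filter Q), Finset.card_filter]
    · push_cast
      rfl
    · intro s
      simp only [Finset.mem_filter, Finset.mem_range, and_iff_right_iff_imp]
      exact fun h => not_le.1 fun h' => hQ s h' h
  have h1 : (Nat.card (freeIndices P) : ℤ) = ∑ w ∈ Finset.range (W + 1),
      ((Finset.univ.filter fun r => (w, r) ∈ freeIndices P).card : ℤ) := by
    rw [Nat.card_coe_set_eq, Set.ncard_eq_toFinset_card _ (finite_freeIndices P)]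
    rw [Finset.card_eq_sum_card_fiberwise (f := Prod.fst) (t := Finset.range (W + 1))]
    · push_cast
      refine Finset.sum_congr rfl fun w _ => ?_
      congr 1
      refine Finset.card_bij' (fun p _ => p.2) (fun r _ => (w, r)) ?_ ?_ ?_ ?_
      · rintro ⟨a, b⟩ h
        simp only [Finset.mem_filter, Set.Finite.mem_toFinset] at h
        obtain ⟨h, rfl⟩ := h
        simpa using h
      · intro r h
        simpa using h
      · rintro ⟨a, b⟩ h
        simp only [Finset.mem_filter] at h
        rw [← h.2]
      · simp
    · intro p hp
      simp only [Set.Finite.coe_toFinset] at hp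
      simp only [Finset.coe_range, Set.mem_Iio]
      exact not_le.1 fun h => hW _ h _ hp.1
  rw [h1, Finset.sum_congr rfl fun w _ => card_freeIndices_weight P w]
  have h2 (a b : ℕ → ℤ) (n : ℕ) : ∑ w ∈ Finset.range n, (a w + b w - b (w + 1)) =
      ∑ w ∈ Finset.range n, a w + b 0 - b n := by
    simp only [add_sub_assoc, Finset.sum_add_distrib, Finset.sum_range_sub']
  rw [h2]
  have hd : NeZero d := ⟨fun h => NeZero.ne N (Nat.eq_zero_of_zero_dvd (h ▸ T.dvd_N))⟩
  have h3 (s) (hs : ∀ r, ¬ T.IsEqn s r) : Nat.card {j // T.Susp s j} = 0 := by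
    rw [Nat.card_eq_zero]
    refine Or.inl ⟨fun j => hs _ (j.2 (P.base j) (P.cl_base _))⟩
  rw [h3 0 not_isEqn_zero, h3 (W + 1) fun r hr => hW _ (Nat.lt_succ_self W) r hr.isVar]
  rw [Finset.sum_sub_distrib, Finset.sum_sub_distrib]
  simp only [hcard _ fun s hs => hW s hs _, hcard _ fun s hs h => hW s hs _ (IsEqn.isVar h)]
  rw [Finset.sum_comm, Finset.sum_comm (s := Finset.univ)]
  simp

end Staircase

/-! ### Lattices of power series -/

section PowerSeriesLattice

variable {N : ℕ} {R : Type*} [CommRing R]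

variable (N R) in
/-- The ring `R[[t ^ N]]` of power series in `t ^ N`. -/
def xRing : Subalgebra R R⟦X⟧ where
  carrier := {A | ∀ k, ¬ N ∣ k → PowerSeries.coeff k A = 0}
  add_mem' {a b} ha hb k hk := by rw [map_add, ha k hk, hb k hk, add_zero]
  mul_mem' {a b} ha hb k hk := by
    rw [PowerSeries.coeff_mul]
    refine Finset.sum_eq_zero fun p hp => ?_
    rw [Finset.HasAntidiagonal.mem_antidiagonal] at hp
    by_cases h1 : N ∣ p.1
    · rw [hb p.2 fun h2 => hk (hp ▸ dvd_add h1 h2), mul_zero]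
    · rw [ha p.1 h1, zero_mul]
  algebraMap_mem' r k hk := by
    rw [PowerSeries.algebraMap_apply, Algebra.algebraMap_self_apply, PowerSeries.coeff_C, if_neg]
    rintro rfl
    exact hk (dvd_zero N)

/-- The sum `∑ b, E_b t ^ b H_b` of shifts of the power series `H_r = ∑ l, h l r * t ^ l`, which
depend on `b` modulo `N` only. -/
noncomputable def comb (h : ℕ → ZMod N → R) : R⟦X⟧ →+ R⟦X⟧ where
  toFun E := PowerSeries.mk fun k =>
    ∑ p ∈ antidiagonal k, PowerSeries.coeff p.1 E * h p.2 (p.1 : ℕ)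
  map_zero' := by ext; simp
  map_add' E E' := by ext; simp [add_mul, Finset.sum_add_distrib]

theorem coeff_comb (h : ℕ → ZMod N → R) (E : R⟦X⟧) (k : ℕ) : PowerSeries.coeff k (comb h E) =
    ∑ p ∈ antidiagonal k, PowerSeries.coeff p.1 E * h p.2 (p.1 : ℕ) := by
  simp [comb]

theorem coeff_comb' {h : ℕ → ZMod N → R} (h0 : ∀ r, h 0 r = 1) (E : R⟦X⟧) (k : ℕ) :
    PowerSeries.coeff k (comb h E) =
      ∑ b ∈ Finset.range k, PowerSeries.coeff b E * h (k - b) (b : ℕ) + PowerSeries.coeff k E := by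
  rw [coeff_comb, Finset.Nat.sum_antidiagonal_eq_sum_range_succ
    (fun b l => PowerSeries.coeff b E * h l (b : ℕ)), Finset.sum_range_succ, Nat.sub_self, h0,
    mul_one]

theorem comb_eq_mul {h : ℕ → ZMod N → R} {E : R⟦X⟧} {q : ZMod N}
    (hE : ∀ k : ℕ, (k : ZMod N) ≠ q → PowerSeries.coeff k E = 0) :
    comb h E = E * PowerSeries.mk fun l => h l q := by
  ext k
  rw [coeff_comb, PowerSeries.coeff_mul]
  refine Finset.sum_congr rfl fun p _ => ?_
  by_cases hp : (p.1 : ZMod N) = q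
  · rw [hp, PowerSeries.coeff_mk]
  · rw [hE _ hp, zero_mul, zero_mul]

/-- If `E` is supported on `D` and the coefficients of `comb h E` at the elements of `D` below `K`
vanish, then all coefficients of `E` below `K` vanish. -/
theorem coeff_eq_zero_of_comb {h : ℕ → ZMod N → R} (h0 : ∀ r, h 0 r = 1) {E : R⟦X⟧} {D : Set ℕ}
    (hE : ∀ k ∉ D, PowerSeries.coeff k E = 0) {K : ℕ}
    (hK : ∀ k < K, k ∈ D → PowerSeries.coeff k (comb h E) = 0) (k : ℕ) (hk : k < K) :
    PowerSeries.coeff k E = 0 := by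
  induction k using Nat.strong_induction_on with
  | _ k ih =>
    by_cases hD : k ∈ D
    · have := hK k hk hD
      rw [coeff_comb' h0, Finset.sum_eq_zero, zero_add] at this
      · exact this
      · intro b hb
        rw [Finset.mem_range] at hb
        rw [ih b hb (hb.trans hk), zero_mul]
    · exact hE k hD

open Classical in
/-- The coefficients of `E` such that `comb h E` has the coefficients `u` on `D`. -/
noncomputable def combSolve (h : ℕ → ZMod N → R) (D : Set ℕ) (u : ℕ → R) (k : ℕ) : R :=
  if k ∈ D then u k - ∑ b : Fin k, combSolve h D u b * h (k - b) ((b : ℕ) : ZMod N) else 0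
termination_by k
decreasing_by exact b.2

theorem exists_comb {h : ℕ → ZMod N → R} (h0 : ∀ r, h 0 r = 1) (D : Set ℕ) (u : ℕ → R) :
    ∃ E : R⟦X⟧, (∀ k ∉ D, PowerSeries.coeff k E = 0) ∧
      ∀ k ∈ D, PowerSeries.coeff k (comb h E) = u k := by
  refine ⟨PowerSeries.mk (combSolve h D u), fun k hk => ?_, fun k hk => ?_⟩
  · rw [PowerSeries.coeff_mk, combSolve, if_neg hk]
  · rw [coeff_comb' h0]
    simp only [PowerSeries.coeff_mk]
    rw [combSolve.eq_def h D u k, if_pos hk, Finset.sum_range]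
    ring

/-- The element `f_q = t ^ gen q * ∑ l, h l q * t ^ l`. -/
noncomputable def basisVec (gen : ZMod N → ℕ) (h : ℕ → ZMod N → R) (q : ZMod N) : R⟦X⟧ :=
  PowerSeries.X ^ gen q * PowerSeries.mk fun l => h l q

/-- The `R[[t ^ N]]`-submodule of `R[[t]]` generated by the elements `basisVec gen h q`. -/
noncomputable def lattice (gen : ZMod N → ℕ) (h : ℕ → ZMod N → R) : Submodule (xRing N R) R⟦X⟧ :=
  Submodule.span (xRing N R) (Set.range (basisVec gen h))

theorem coeff_basisVec_of_lt (gen : ZMod N → ℕ) (h : ℕ → ZMod N → R) (q : ZMod N) {k : ℕ}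
    (hk : k < gen q) : PowerSeries.coeff k (basisVec gen h q) = 0 := by
  rw [basisVec, PowerSeries.coeff_X_pow_mul', if_neg (by omega)]

theorem coeff_basisVec_add (gen : ZMod N → ℕ) (h : ℕ → ZMod N → R) (q : ZMod N) (l : ℕ) :
    PowerSeries.coeff (gen q + l) (basisVec gen h q) = h l q := by
  rw [basisVec, add_comm, PowerSeries.coeff_X_pow_mul, PowerSeries.coeff_mk]

variable {gen : ZMod N → ℕ} {Δ : Set ℕ}

theorem exists_xRing_mul (hgen : ∀ r, (gen r : ZMod N) = r) {E : R⟦X⟧} {q : ZMod N}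
    (h1 : ∀ k : ℕ, (k : ZMod N) ≠ q → PowerSeries.coeff k E = 0)
    (h2 : ∀ k < gen q, PowerSeries.coeff k E = 0) :
    ∃ A ∈ xRing N R, E = A * PowerSeries.X ^ gen q := by
  obtain ⟨A, rfl⟩ := PowerSeries.X_pow_dvd_iff.2 h2
  refine ⟨A, fun k hk => ?_, mul_comm _ _⟩
  rw [← PowerSeries.coeff_X_pow_mul A (gen q) k]
  refine h1 _ fun h => hk ?_
  rw [Nat.cast_add, hgen, add_eq_right] at h
  exact (ZMod.natCast_eq_zero_iff _ _).1 h

theorem mul_mem_lattice (hgen : ∀ r, (gen r : ZMod N) = r) (h : ℕ → ZMod N → R) {E : R⟦X⟧}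
    {q : ZMod N} (h1 : ∀ k : ℕ, (k : ZMod N) ≠ q → PowerSeries.coeff k E = 0)
    (h2 : ∀ k < gen q, PowerSeries.coeff k E = 0) :
    (E * PowerSeries.mk fun l => h l q) ∈ lattice gen h := by
  obtain ⟨A, hA, rfl⟩ := exists_xRing_mul hgen h1 h2
  rw [mul_assoc]
  exact (lattice gen h).smul_mem ⟨A, hA⟩ (Submodule.subset_span ⟨q, rfl⟩)

variable [NeZero N]

theorem mem_lattice_iff (hgen : ∀ r, (gen r : ZMod N) = r) (hΔ : ∀ k : ℕ, k ∈ Δ ↔ gen k ≤ k)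
    {h : ℕ → ZMod N → R} {f : R⟦X⟧} : f ∈ lattice gen h ↔
      ∃ E : R⟦X⟧, (∀ k ∉ Δ, PowerSeries.coeff k E = 0) ∧ comb h E = f := by
  classical
  constructor
  · intro hf
    obtain ⟨A, rfl⟩ := (Submodule.mem_span_range_iff_exists_fun _).1 hf
    have hsupp (q : ZMod N) (k : ℕ)
        (hk : PowerSeries.coeff k ((A q : R⟦X⟧) * PowerSeries.X ^ gen q) ≠ 0) :
        gen q ≤ k ∧ (k : ZMod N) = q := by
      rw [PowerSeries.coeff_mul_X_pow'] at hk
      split_ifs at hk with h1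
      · refine ⟨h1, ?_⟩
        have h2 : N ∣ k - gen q := by
          by_contra h2
          exact hk ((A q).2 _ h2)
        rw [← ZMod.natCast_eq_zero_iff, Nat.cast_sub h1, hgen, sub_eq_zero] at h2
        exact h2
      · exact absurd rfl hk
    refine ⟨∑ q, (A q : R⟦X⟧) * PowerSeries.X ^ gen q, fun k hk => ?_, ?_⟩
    · rw [map_sum]
      refine Finset.sum_eq_zero fun q _ => ?_
      by_contra h
      obtain ⟨h1, h2⟩ := hsupp q k h
      exact hk ((hΔ k).2 (h2 ▸ h1))
    · rw [map_sum]
      refine Finset.sum_congr rfl fun q _ => ?_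
      rw [comb_eq_mul (q := q) fun k hk => not_not.1 fun h => hk (hsupp q k h).2, mul_assoc]
      rfl
  · rintro ⟨E, hE, rfl⟩
    have e : E = ∑ q : ZMod N, PowerSeries.mk fun k =>
        if (k : ZMod N) = q then PowerSeries.coeff k E else 0 := by
      ext k
      simp
    rw [e, map_sum]
    refine Submodule.sum_mem _ fun q _ => ?_
    have h1 : ∀ k : ℕ, (k : ZMod N) ≠ q → PowerSeries.coeff k (PowerSeries.mk fun k : ℕ =>
        if (k : ZMod N) = q then PowerSeries.coeff k E else 0) = 0 := fun k hk => by simp [hk]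
    rw [comb_eq_mul h1]
    refine mul_mem_lattice hgen h h1 fun k hk => ?_
    rw [PowerSeries.coeff_mk]
    split_ifs with hq
    · refine hE k fun hk' => ?_
      rw [hΔ, hq] at hk'
      omega
    · rfl

theorem exists_mem_lattice (hgen : ∀ r, (gen r : ZMod N) = r) (hΔ : ∀ k : ℕ, k ∈ Δ ↔ gen k ≤ k)
    {h : ℕ → ZMod N → R} (h0 : ∀ r, h 0 r = 1) (u : ℕ → R) :
    ∃ f ∈ lattice gen h, ∀ k ∈ Δ, PowerSeries.coeff k f = u k := by
  obtain ⟨E, h1, h2⟩ := exists_comb h0 Δ u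
  exact ⟨_, (mem_lattice_iff hgen hΔ).2 ⟨E, h1, rfl⟩, h2⟩

theorem coeff_eq_zero_of_mem_lattice (hgen : ∀ r, (gen r : ZMod N) = r)
    (hΔ : ∀ k : ℕ, k ∈ Δ ↔ gen k ≤ k) {h : ℕ → ZMod N → R} (h0 : ∀ r, h 0 r = 1) {f : R⟦X⟧}
    (hf : f ∈ lattice gen h) {k : ℕ} (hk : k ∉ Δ) (hlt : ∀ i < k, PowerSeries.coeff i f = 0) :
    PowerSeries.coeff k f = 0 := by
  obtain ⟨E, hE, rfl⟩ := (mem_lattice_iff hgen hΔ).1 hf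
  rw [coeff_comb' h0, hE k hk, add_zero]
  refine Finset.sum_eq_zero fun b hb => ?_
  rw [coeff_eq_zero_of_comb h0 hE (fun k hk _ => hlt k hk) b (Finset.mem_range.1 hb), zero_mul]

theorem mem_lattice_of_coeff_eq_zero (hgen : ∀ r, (gen r : ZMod N) = r) {h : ℕ → ZMod N → R}
    (h0 : ∀ r, h 0 r = 1) {f : R⟦X⟧} (hf : ∀ k : ℕ, k < ∑ r, gen r → PowerSeries.coeff k f = 0) :
    f ∈ lattice gen h := by
  obtain ⟨E, -, h2⟩ := exists_comb h0 Set.univ (fun k => PowerSeries.coeff k f)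
  have e : comb h E = f := by
    ext k
    exact h2 k trivial
  refine (mem_lattice_iff (Δ := {k : ℕ | gen k ≤ k}) hgen fun _ => Iff.rfl).2
    ⟨E, fun k hk => ?_, e⟩
  refine coeff_eq_zero_of_comb h0 (D := Set.univ) (by simp) (fun k hk _ => e ▸ hf k hk) k ?_
  have := Finset.single_le_sum (f := gen) (fun _ _ => Nat.zero_le _) (Finset.mem_univ (k : ZMod N))
  simp only [Set.mem_ofPred_eq, not_le] at hk
  omega

/-- The lattice is stable under multiplication by `t ^ M * ∑ i, y i * t ^ i` if its product with each
basis element `t ^ gen r * H_r` has an expansion `∑ s, c s r * t ^ (gen r + M + s) * H_(r + M + s)`,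
where `c s r` vanishes unless `gen r + M + s` is at least the generator of its residue class. -/
theorem mul_mem_lattice_of_expansion (hgen : ∀ r, (gen r : ZMod N) = r) {M : ℕ} {y : ℕ → R}
    {h c : ℕ → ZMod N → R} (hc : ∀ (s : ℕ) (r : ZMod N), gen r + M + s < gen (r + M + s) → c s r = 0)
    (hyc : ∀ (s : ℕ) (r : ZMod N), ∑ p ∈ antidiagonal s, y p.1 * h p.2 r =
      ∑ p ∈ antidiagonal s, c p.1 r * h p.2 (r + M + (p.1 : ℕ)))
    {f : R⟦X⟧} (hf : f ∈ lattice gen h) :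
    PowerSeries.X ^ M * PowerSeries.mk y * f ∈ lattice gen h := by
  classical
  induction hf using Submodule.span_induction with
  | zero => rw [mul_zero]; exact zero_mem _
  | add a b _ _ ha hb => rw [mul_add]; exact add_mem ha hb
  | smul A a _ ha => rw [mul_smul_comm]; exact (lattice gen h).smul_mem A ha
  | mem f hf =>
    obtain ⟨q, rfl⟩ := hf
    have e : PowerSeries.X ^ M * PowerSeries.mk y * basisVec gen h q =
        ∑ p : ZMod N, (PowerSeries.X ^ (gen q + M) * PowerSeries.mk fun s : ℕ =>
          if q + M + s = p then c s q else 0) * PowerSeries.mk fun l => h l p := by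
      have e1 : PowerSeries.mk y * (PowerSeries.mk fun l => h l q) =
          ∑ p : ZMod N, (PowerSeries.mk fun s : ℕ => if q + M + s = p then c s q else 0) *
            PowerSeries.mk fun l => h l p := by
        ext s
        simp only [map_sum, PowerSeries.coeff_mul, PowerSeries.coeff_mk]
        rw [Finset.sum_comm, hyc]
        simp
      simp only [mul_assoc, ← Finset.mul_sum, basisVec, pow_add]
      rw [← e1]
      ring
    rw [e]
    refine Submodule.sum_mem _ fun p _ => mul_mem_lattice hgen h (fun k hk => ?_) fun k hk => ?_
    all_goals
      rw [PowerSeries.coeff_X_pow_mul']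
      split_ifs with h1
      swap
      · rfl
      rw [PowerSeries.coeff_mk]
      obtain ⟨s, rfl⟩ := Nat.exists_eq_add_of_le h1
      rw [Nat.add_sub_cancel_left]
      split_ifs with h2
      swap
      · rfl
    · refine absurd ?_ hk
      rw [← h2]
      push_cast
      rw [hgen]
    · refine hc s q ?_
      rwa [h2]

end PowerSeriesLattice

/-! ### Modules on the curve and their normal forms -/

namespace GenericCurve

variable {n m d : ℕ} (C : GenericCurve n m d) {R : Type} [CommRing R] [Algebra ℂ R]

/-- The coefficients of `y(t) / t ^ (m * d)`, in `R`. -/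
noncomputable def yCoeff (R : Type) [CommRing R] [Algebra ℂ R] (i : ℕ) : R :=
  algebraMap ℂ R (PowerSeries.coeff (m * d + i) C.y)

theorem map_y_eq : PowerSeries.map (algebraMap ℂ R) C.y =
    PowerSeries.X ^ (m * d) * PowerSeries.mk (C.yCoeff R) := by
  ext k
  rw [PowerSeries.coeff_map, PowerSeries.coeff_X_pow_mul']
  split_ifs with h
  · rw [PowerSeries.coeff_mk, yCoeff, Nat.add_sub_cancel' h]
  · rw [C.coeff_y_lt k (by omega), map_zero]

theorem constantCoeff_param (i : Fin 2) : MvPowerSeries.constantCoeff (C.param R i) = 0 := by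
  have hn := C.n_pos
  have hm := C.m_pos
  have hd := C.d_pos
  change PowerSeries.constantCoeff (C.param R i) = 0
  fin_cases i
  · simp [param, hn.ne', hd.ne']
  · have h := C.coeff_y_lt 0 (Nat.mul_pos hm hd)
    rw [PowerSeries.coeff_zero_eq_constantCoeff_apply] at h
    simp [param, ← PowerSeries.coeff_zero_eq_constantCoeff_apply, h]

theorem param_mem (i : Fin 2) : C.param R i ∈ C.functionRing R :=
  ⟨MvPowerSeries.X i, by
    change MvPowerSeries.substAlgHom (C.hasSubst_param R) _ = _
    rw [MvPowerSeries.substAlgHom_X]⟩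

theorem y_mem : PowerSeries.X ^ (m * d) * PowerSeries.mk (C.yCoeff R) ∈ C.functionRing R := by
  rw [← map_y_eq]
  exact C.param_mem 1

theorem xRing_le : xRing (n * d) R ≤ C.functionRing R := by
  intro A hA
  let F : MvPowerSeries (Fin 2) R :=
    fun e => if e 1 = 0 then PowerSeries.coeff (n * d * e 0) A else 0
  refine ⟨F, ?_⟩
  change MvPowerSeries.substAlgHom (C.hasSubst_param R) F = A
  rw [MvPowerSeries.substAlgHom_apply]
  have hN : 0 < n * d := Nat.mul_pos C.n_pos C.d_pos
  ext k
  change MvPowerSeries.coeff (Finsupp.single () k) (F.subst (C.param R)) = _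
  rw [MvPowerSeries.coeff_subst (C.hasSubst_param R)]
  have hterm (e : Fin 2 →₀ ℕ) (he : e 1 = 0) :
      MvPowerSeries.coeff (Finsupp.single () k) (e.prod fun s i => C.param R s ^ i) =
        if k = n * d * e 0 then (1 : R) else 0 := by
    rw [Finsupp.prod_fintype _ _ (fun _ => pow_zero _), Fin.prod_univ_two, he, pow_zero, mul_one]
    change PowerSeries.coeff k ((PowerSeries.X ^ (n * d)) ^ e 0) = _
    rw [← pow_mul, PowerSeries.coeff_X_pow]
  rw [finsum_eq_single _ (Finsupp.single 0 (k / (n * d)))]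
  · rw [hterm _ (by simp)]
    change (if (Finsupp.single 0 (k / (n * d)) : Fin 2 →₀ ℕ) 1 = 0 then _ else _) • _ = _
    rw [if_pos (by simp), Finsupp.single_eq_same]
    split_ifs with h
    · rw [← h, smul_eq_mul, mul_one]
    · rw [smul_zero]
      exact (hA k fun h' => h (Nat.mul_div_cancel' h').symm).symm
  · intro e he
    change (if e 1 = 0 then _ else _) • _ = (0 : R)
    split_ifs with h1
    · rw [hterm e h1, if_neg, smul_zero]
      rintro rfl
      refine he (Finsupp.ext fun i => ?_)
      fin_cases i
      · simp [Nat.mul_div_cancel_left _ hN]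
      · simpa using h1
    · rw [zero_smul]

/-- Modulo a power of `t` every function is a polynomial in `x` and `y`. -/
theorem exists_mem_adjoin {φ : R⟦X⟧} (hφ : φ ∈ C.functionRing R) (K : ℕ) :
    ∃ p ∈ Algebra.adjoin R (Set.range (C.param R)),
      ∀ i < K, PowerSeries.coeff i φ = PowerSeries.coeff i p := by
  obtain ⟨F, rfl⟩ := hφ
  refine ⟨MvPolynomial.aeval (C.param R) (F.truncTotal K), ?_, fun i hi => ?_⟩
  · rw [Algebra.adjoin_range_eq_range_aeval]
    exact ⟨_, rfl⟩
  · have h := MvPowerSeries.truncTotal_subst_eq_truncTotal_truncTotal_subst (f := F) (k := K)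
      (C.constantCoeff_param (R := R))
    have h2 := congrArg (MvPolynomial.coeff (Finsupp.single () i)) h
    rw [MvPowerSeries.coeff_truncTotal _ (by simpa using hi),
      MvPowerSeries.coeff_truncTotal _ (by simpa using hi),
      ← MvPowerSeries.substAlgHom_apply (C.hasSubst_param R),
      ← MvPowerSeries.substAlgHom_apply (C.hasSubst_param R), MvPowerSeries.substAlgHom_coe] at h2
    exact h2

end GenericCurve

section Families

variable {n m d : ℕ} {C : GenericCurve n m d} {R : Type} [CommRing R] [Algebra ℂ R]
  {gen : ZMod (n * d) → ℕ} {Δ : Set ℕ}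

theorem smul_mem_lattice [NeZero (n * d)] (hgen : ∀ r, (gen r : ZMod (n * d)) = r)
    {h : ℕ → ZMod (n * d) → R} (h0 : ∀ r, h 0 r = 1)
    (hy : ∀ f ∈ lattice gen h,
      PowerSeries.X ^ (m * d) * PowerSeries.mk (C.yCoeff R) * f ∈ lattice gen h)
    {φ : R⟦X⟧} (hφ : φ ∈ C.functionRing R) {f : R⟦X⟧} (hf : f ∈ lattice gen h) :
    φ * f ∈ lattice gen h := by
  obtain ⟨p, hp, hpφ⟩ := C.exists_mem_adjoin hφ (∑ r, gen r)
  have h1 : p * f ∈ lattice gen h := by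
    clear hpφ
    revert f
    induction hp using Algebra.adjoin_induction with
    | mem a ha =>
      intro f hf
      obtain ⟨i, rfl⟩ := ha
      fin_cases i
      · refine (lattice gen h).smul_mem ⟨PowerSeries.X ^ (n * d), fun k hk => ?_⟩ hf
        rw [PowerSeries.coeff_X_pow, if_neg]
        rintro rfl
        exact hk dvd_rfl
      · have := hy f hf
        rwa [← C.map_y_eq] at this
    | algebraMap r =>
      intro f hf
      exact (lattice gen h).smul_mem (algebraMap R (xRing (n * d) R) r) hf
    | add a b _ _ ha hb =>
      intro f hf
      rw [add_mul]
      exact add_mem (ha hf) (hb hf)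
    | mul a b _ _ ha hb =>
      intro f hf
      rw [mul_assoc]
      exact ha (hb hf)
  have h2 : (φ - p) * f ∈ lattice gen h := by
    refine mem_lattice_of_coeff_eq_zero hgen h0 fun k hk => ?_
    rw [PowerSeries.coeff_mul]
    refine Finset.sum_eq_zero fun q hq => ?_
    rw [map_sub, hpφ q.1 ((Finset.HasAntidiagonal.antidiagonal.fst_le hq).trans_lt hk), sub_self,
      zero_mul]
  have := add_mem h1 h2
  rwa [← add_mul, add_sub_cancel] at this

variable (C) in
/-- The lattice with basis `basisVec gen h`, as a module over the functions on the curve. -/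
noncomputable def latticeModule [NeZero (n * d)] (hgen : ∀ r, (gen r : ZMod (n * d)) = r)
    (h : ℕ → ZMod (n * d) → R) (h0 : ∀ r, h 0 r = 1)
    (hy : ∀ f ∈ lattice gen h,
      PowerSeries.X ^ (m * d) * PowerSeries.mk (C.yCoeff R) * f ∈ lattice gen h) :
    Submodule (C.functionRing R) R⟦X⟧ where
  carrier := lattice gen h
  zero_mem' := zero_mem (lattice gen h)
  add_mem' := add_mem
  smul_mem' φ _ hf := smul_mem_lattice hgen h0 hy φ.2 hf

theorem lattice_mem_stratumPoints [NeZero (n * d)] (hgen : ∀ r, (gen r : ZMod (n * d)) = r)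
    (hΔ : ∀ k : ℕ, k ∈ Δ ↔ gen k ≤ k) {h : ℕ → ZMod (n * d) → R} (h0 : ∀ r, h 0 r = 1)
    {M : Submodule (C.functionRing R) R⟦X⟧} (hM : ∀ f, f ∈ M ↔ f ∈ lattice gen h) :
    M ∈ C.stratumPoints Δ R := by
  refine ⟨fun k hk => Set.eq_univ_of_forall fun a => ?_, fun k hk => ?_⟩
  · refine ⟨comb h (PowerSeries.monomial k a), ?_, fun i hi => ?_, ?_⟩
    · rw [hM, mem_lattice_iff hgen hΔ]
      refine ⟨_, fun i hi => ?_, rfl⟩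
      rw [PowerSeries.coeff_monomial, if_neg]
      rintro rfl
      exact hi hk
    · rw [coeff_comb' h0, PowerSeries.coeff_monomial, if_neg hi.ne, add_zero]
      refine Finset.sum_eq_zero fun b hb => ?_
      rw [PowerSeries.coeff_monomial, if_neg ((Finset.mem_range.1 hb).trans hi).ne, zero_mul]
    · rw [coeff_comb' h0, PowerSeries.coeff_monomial_same, Finset.sum_eq_zero, zero_add]
      intro b hb
      rw [PowerSeries.coeff_monomial, if_neg (Finset.mem_range.1 hb).ne, zero_mul]
  · ext c
    constructor
    · rintro ⟨f, hf, hlt, rfl⟩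
      exact coeff_eq_zero_of_mem_lattice hgen hΔ h0 ((hM f).1 hf) hk hlt
    · rintro rfl
      exact ⟨0, M.zero_mem, by simp, by simp⟩

section Points

variable {M : Submodule (C.functionRing R) R⟦X⟧}

theorem coeff_eq_zero_of_mem (hM : M ∈ C.stratumPoints Δ R) {f : R⟦X⟧} (hf : f ∈ M)
    {K : ℕ}
    (hK : ∀ k < K, k ∈ Δ → PowerSeries.coeff k f = 0) (k : ℕ) (hk : k < K) :
    PowerSeries.coeff k f = 0 := by
  induction k using Nat.strong_induction_on with
  | _ k ih =>
    by_cases hD : k ∈ Δ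
    · exact hK k hk hD
    · have : PowerSeries.coeff k f ∈ leadingCoeffs M k :=
        ⟨f, hf, fun i hi => ih i hi (hi.trans hk), rfl⟩
      rw [hM.2 k hD] at this
      exact this

theorem eq_zero_of_mem (hM : M ∈ C.stratumPoints Δ R) {f : R⟦X⟧} (hf : f ∈ M)
    (h : ∀ k ∈ Δ, PowerSeries.coeff k f = 0) :
    f = 0 := by
  ext k
  exact coeff_eq_zero_of_mem hM hf (K := k + 1) (fun k _ hk => h k hk) k (Nat.lt_succ_self k)

theorem lattice_le {h : ℕ → ZMod (n * d) → R} (hb : ∀ q, basisVec gen h q ∈ M) {f : R⟦X⟧}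
    (hf : f ∈ lattice gen h) : f ∈ M := by
  induction hf using Submodule.span_induction with
  | zero => exact M.zero_mem
  | add a b _ _ ha hb => exact M.add_mem ha hb
  | smul A a _ ha => exact M.smul_mem ⟨A, C.xRing_le A.2⟩ ha
  | mem f hf =>
    obtain ⟨q, rfl⟩ := hf
    exact hb q

/-- A family of elements with leading terms `t ^ gen q` generates. -/
theorem mem_iff_mem_lattice [NeZero (n * d)] (hM : M ∈ C.stratumPoints Δ R)
    (hgen : ∀ r, (gen r : ZMod (n * d)) = r)
    (hΔ : ∀ k : ℕ, k ∈ Δ ↔ gen k ≤ k) {h : ℕ → ZMod (n * d) → R} (h0 : ∀ r, h 0 r = 1)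
    (hb : ∀ q, basisVec gen h q ∈ M) (f : R⟦X⟧) : f ∈ M ↔ f ∈ lattice gen h := by
  refine ⟨fun hf => ?_, lattice_le hb⟩
  obtain ⟨f', hf', he⟩ := exists_mem_lattice hgen hΔ h0 fun k => PowerSeries.coeff k f
  have := eq_zero_of_mem hM (M.sub_mem hf (lattice_le hb hf')) fun k hk => by
    rw [map_sub, he k hk, sub_self]
  rwa [sub_eq_zero.1 this]

theorem exists_mem_coeff_eq [NeZero (n * d)] (hM : M ∈ C.stratumPoints Δ R)
    (hgen : ∀ r, (gen r : ZMod (n * d)) = r)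
    (hΔ : ∀ k : ℕ, k ∈ Δ ↔ gen k ≤ k) (u : ℕ → R) :
    ∃ f ∈ M, ∀ k ∈ Δ, PowerSeries.coeff k f = u k := by
  have hlead (q : ZMod (n * d)) : ∃ f ∈ M, (∀ i < gen q, PowerSeries.coeff i f = 0) ∧
      PowerSeries.coeff (gen q) f = 1 := by
    have : (1 : R) ∈ leadingCoeffs M (gen q) := by
      rw [hM.1 _ ((hΔ _).2 (by rw [hgen]))]
      trivial
    exact this
  choose F hF1 hF2 hF3 using hlead
  have hb (q : ZMod (n * d)) :
      basisVec gen (fun l q => PowerSeries.coeff (gen q + l) (F q)) q = F q := by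
    ext k
    rcases lt_or_ge k (gen q) with hk | hk
    · rw [coeff_basisVec_of_lt _ _ _ hk, hF2 q k hk]
    · obtain ⟨l, rfl⟩ := Nat.exists_eq_add_of_le hk
      rw [coeff_basisVec_add]
  obtain ⟨f, hf, he⟩ := exists_mem_lattice hgen hΔ
    (h := fun l q => PowerSeries.coeff (gen q + l) (F q)) (fun r => hF3 r) u
  exact ⟨f, lattice_le (fun q => by rw [hb]; exact hF1 q) hf, he⟩

end Points

variable {T : Staircase (n * d) d (m * d)}

theorem isVar_iff (hgen : ∀ r, (T.gen r : ZMod (n * d)) = r) (hΔ : ∀ k : ℕ, k ∈ Δ ↔ T.gen k ≤ k)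
    (s : ℕ) (r : ZMod (n * d)) : T.IsVar s r ↔ T.gen r + s ∉ Δ := by
  rw [hΔ, Staircase.IsVar, not_le]
  push_cast
  rw [hgen]

theorem isEqn_iff (hgen : ∀ r, (T.gen r : ZMod (n * d)) = r) (hΔ : ∀ k : ℕ, k ∈ Δ ↔ T.gen k ≤ k)
    (s : ℕ) (r : ZMod (n * d)) : T.IsEqn s r ↔ T.gen r + m * d + s ∉ Δ := by
  rw [hΔ, Staircase.IsEqn, not_le]
  push_cast
  rw [hgen]

/-- The lattice of a solution is stable under multiplication by `y`. -/
theorem Staircase.IsSolution.y_mul_mem [NeZero (n * d)] 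
    (hgen : ∀ r, (T.gen r : ZMod (n * d)) = r)
    {g : ℕ → ZMod (n * d) → R} (hg : T.IsSolution (C.yCoeff R) g) (f : R⟦X⟧)
    (hf : f ∈ lattice T.gen g) :
    PowerSeries.X ^ (m * d) * PowerSeries.mk (C.yCoeff R) * f ∈ lattice T.gen g := by
  obtain ⟨c, hc, hyc⟩ := hg.exists_quot
  refine mul_mem_lattice_of_expansion hgen (c := c) (fun s r h => hc s r ?_) hyc hf
  unfold Staircase.IsEqn
  exact_mod_cast h

/-- The elements of the normal form are determined by the module. -/
theorem Staircase.IsSolution.ext_lattice [NeZero (n * d)] 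
    (hgen : ∀ r, (T.gen r : ZMod (n * d)) = r)
    (hΔ : ∀ k : ℕ, k ∈ Δ ↔ T.gen k ≤ k) {g g' : ℕ → ZMod (n * d) → R}
    (hg : T.IsSolution (C.yCoeff R) g) (hg' : T.IsSolution (C.yCoeff R) g')
    {M : Submodule (C.functionRing R) R⟦X⟧} (hM : ∀ f, f ∈ M ↔ f ∈ lattice T.gen g)
    (hM' : ∀ f, f ∈ M ↔ f ∈ lattice T.gen g') : g = g' := by
  have hmem := lattice_mem_stratumPoints hgen hΔ hg.zero hM
  funext l q
  have h1 : basisVec T.gen g q - basisVec T.gen g' q = 0 := by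
    refine eq_zero_of_mem hmem (M.sub_mem ((hM _).2 (Submodule.subset_span ⟨q, rfl⟩))
      ((hM' _).2 (Submodule.subset_span ⟨q, rfl⟩))) fun k hk => ?_
    rw [map_sub, sub_eq_zero]
    rcases lt_or_ge k (T.gen q) with hlt | hge
    · rw [coeff_basisVec_of_lt _ _ _ hlt, coeff_basisVec_of_lt _ _ _ hlt]
    · obtain ⟨s, rfl⟩ := Nat.exists_eq_add_of_le hge
      rw [coeff_basisVec_add, coeff_basisVec_add]
      rcases eq_or_ne s 0 with rfl | hs
      · rw [hg.zero, hg'.zero]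
      · have : ¬ T.IsVar s q := fun h => (isVar_iff hgen hΔ s q).1 h hk
        rw [hg.eq_zero s hs q this, hg'.eq_zero s hs q this]
  rw [← coeff_basisVec_add T.gen g, ← coeff_basisVec_add T.gen g', sub_eq_zero.1 h1]

/-- Every point of the stratum has a normal form. -/
theorem exists_isSolution_of_mem_stratumPoints [NeZero (n * d)] 
    (hgen : ∀ r, (T.gen r : ZMod (n * d)) = r)
    (hΔ : ∀ k : ℕ, k ∈ Δ ↔ T.gen k ≤ k)
    {M : Submodule (C.functionRing R) R⟦X⟧} (hM : M ∈ C.stratumPoints Δ R) :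
    ∃ g, T.IsSolution (C.yCoeff R) g ∧ ∀ f, f ∈ M ↔ f ∈ lattice T.gen g := by
  classical
  choose F hF1 hF2 using fun q : ZMod (n * d) =>
    exists_mem_coeff_eq hM hgen hΔ fun k => if k = T.gen q then 1 else 0
  have hgenΔ (q : ZMod (n * d)) : T.gen q ∈ Δ := (hΔ _).2 (by rw [hgen])
  have hF3 (q : ZMod (n * d)) : ∀ i < T.gen q, PowerSeries.coeff i (F q) = 0 := by
    refine coeff_eq_zero_of_mem hM (hF1 q) fun k hk hkΔ => ?_
    rw [hF2 q k hkΔ, if_neg hk.ne]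
  set g : ℕ → ZMod (n * d) → R := fun l q => PowerSeries.coeff (T.gen q + l) (F q) with hgdef
  have hb (q : ZMod (n * d)) : basisVec T.gen g q = F q := by
    ext k
    rcases lt_or_ge k (T.gen q) with hk | hk
    · rw [coeff_basisVec_of_lt _ _ _ hk, hF3 q k hk]
    · obtain ⟨l, rfl⟩ := Nat.exists_eq_add_of_le hk
      rw [coeff_basisVec_add]
  have h0 (r : ZMod (n * d)) : g 0 r = 1 := by
    rw [hgdef]
    simp only [add_zero]
    rw [hF2 r _ (hgenΔ r), if_pos rfl]
  have hiff := mem_iff_mem_lattice hM hgen hΔ h0 fun q => by rw [hb]; exact hF1 q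
  have hy (q : ZMod (n * d)) : ∃ E : R⟦X⟧, (∀ k ∉ Δ, PowerSeries.coeff k E = 0) ∧ comb g E =
      PowerSeries.X ^ (m * d) * PowerSeries.mk (C.yCoeff R) * F q :=
    (mem_lattice_iff hgen hΔ).1 ((hiff _).1 (M.smul_mem ⟨_, C.y_mem⟩ (hF1 q)))
  choose E hE1 hE2 using hy
  have hcoeff (q : ZMod (n * d)) : comb g (E q) = PowerSeries.X ^ (T.gen q + m * d) *
      (PowerSeries.mk (C.yCoeff R) * PowerSeries.mk fun l => g l q) := by
    rw [hE2, ← hb, basisVec, pow_add]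
    ring
  have hE3 (q : ZMod (n * d)) : ∀ k < T.gen q + m * d, PowerSeries.coeff k (E q) = 0 := by
    refine coeff_eq_zero_of_comb h0 (hE1 q) fun k hk _ => ?_
    rw [hcoeff, PowerSeries.coeff_X_pow_mul', if_neg (by omega)]
  refine ⟨g, ⟨h0, fun s hs r hr => ?_,
    fun s r => PowerSeries.coeff (T.gen r + m * d + s) (E r), fun s r hr => ?_, fun s r => ?_⟩,
    hiff⟩
  · rw [isVar_iff hgen hΔ, not_not] at hr
    exact (hF2 r _ hr).trans (if_neg (by omega))
  · exact hE1 r _ ((isEqn_iff hgen hΔ s r).1 hr)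
  · obtain ⟨E', hE'⟩ := PowerSeries.X_pow_dvd_iff.2 (hE3 r)
    have h1 := congrArg (PowerSeries.coeff (s + (T.gen r + m * d))) (hcoeff r)
    rw [PowerSeries.coeff_X_pow_mul, PowerSeries.coeff_mul] at h1
    simp only [PowerSeries.coeff_mk] at h1
    rw [← h1, coeff_comb,
      Finset.Nat.sum_antidiagonal_eq_sum_range_succ
        (fun b l => PowerSeries.coeff b (E r) * g l (b : ZMod (n * d))),
      Finset.Nat.sum_antidiagonal_eq_sum_range_succ
        (fun b l => PowerSeries.coeff (T.gen r + m * d + b) (E r) *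
          g l (r + ((m * d : ℕ) : ZMod (n * d)) + (b : ZMod (n * d)))),
      show s + (T.gen r + m * d) = T.gen r + m * d + s by ring,
      show (T.gen r + m * d + s).succ = T.gen r + m * d + s.succ by rfl, Finset.sum_range_add,
      Finset.sum_eq_zero, zero_add]
    · refine Finset.sum_congr rfl fun b _ => ?_
      rw [show T.gen r + m * d + s - (T.gen r + m * d + b) = s - b by omega]
      congr 2
      rw [Nat.cast_add, Nat.cast_add, hgen]
    · intro b hb
      rw [hE3 r b (Finset.mem_range.1 hb), zero_mul]

theorem map_basisVec {N : ℕ} {R S : Type*} [CommRing R] [CommRing S] (f : R →+* S)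
    (gen : ZMod N → ℕ) (g : ℕ → ZMod N → R) (q : ZMod N) :
    PowerSeries.map f (basisVec gen g q) = basisVec gen (fun l r => f (g l r)) q := by
  rw [basisVec, basisVec, map_mul, map_pow, PowerSeries.map_X]
  congr 1

/-- Base change of a lattice applies the homomorphism to the coefficients of the normal form. -/
theorem eq_baseChange {S : Type} [CommRing S] [Algebra ℂ S] (f : R →ₐ[ℂ] S)
    {g : ℕ → ZMod (n * d) → R} {M : Submodule (C.functionRing R) R⟦X⟧}
    (hM : ∀ a, a ∈ M ↔ a ∈ lattice gen g) {M' : Submodule (C.functionRing S) S⟦X⟧}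
    (hM' : ∀ a, a ∈ M' ↔ a ∈ lattice gen fun l r => f (g l r)) : M' = C.baseChange f M := by
  apply le_antisymm
  · intro a ha
    have hb (q : ZMod (n * d)) : basisVec gen (fun l r => f (g l r)) q ∈ C.baseChange f M :=
      Submodule.subset_span ⟨basisVec gen g q, (hM _).2 (Submodule.subset_span ⟨q, rfl⟩),
        map_basisVec (f : R →+* S) gen g q⟩
    exact lattice_le hb ((hM' a).1 ha)
  · refine Submodule.span_le.2 ?_
    rintro _ ⟨a, ha, rfl⟩
    refine (hM' _).2 ?_
    have ha' := (hM a).1 ha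
    clear ha
    induction ha' using Submodule.span_induction with
    | zero => rw [map_zero]; exact zero_mem _
    | add a b _ _ ha hb => rw [map_add]; exact add_mem ha hb
    | smul A a _ ha =>
      have : PowerSeries.map (f : R →+* S) (A • a) =
          PowerSeries.map (f : R →+* S) A * PowerSeries.map (f : R →+* S) a := map_mul _ _ _
      rw [this]
      have hA : PowerSeries.map (f : R →+* S) A ∈ xRing (n * d) S := fun k hk => by
        rw [PowerSeries.coeff_map, A.2 k hk, map_zero]
      exact (lattice gen _).smul_mem ⟨_, hA⟩ ha
    | mem a ha =>
      obtain ⟨q, rfl⟩ := ha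
      rw [map_basisVec]
      exact Submodule.subset_span ⟨q, rfl⟩

end Families

/-! ### The generators of an admissible subset, and the parametrization of the stratum -/

section LeastElement

variable {N : ℕ} {Δ : Set ℕ}

/-- The least element of `Δ` in a residue class modulo `N`. -/
noncomputable def leastInClass (N : ℕ) (Δ : Set ℕ) (r : ZMod N) : ℕ :=
  sInf {a | a ∈ Δ ∧ (a : ZMod N) = r}

theorem leastInClass_spec [NeZero N] (hΔ : Δᶜ.Finite) (r : ZMod N) :
    leastInClass N Δ r ∈ Δ ∧ (leastInClass N Δ r : ZMod N) = r := by
  refine Nat.sInf_mem (s := {a | a ∈ Δ ∧ (a : ZMod N) = r}) ?_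
  have hinj : Function.Injective fun k : ℕ => r.val + N * k := fun a b h =>
    Nat.eq_of_mul_eq_mul_left (NeZero.pos N) (Nat.add_left_cancel h)
  obtain ⟨k, hk⟩ := ((Set.infinite_range_of_injective hinj).sdiff hΔ).nonempty
  obtain ⟨⟨i, rfl⟩, hk⟩ := hk
  exact ⟨_, not_not.1 hk, by simp⟩

theorem mem_iff_leastInClass_le [NeZero N] (hΔ : Δᶜ.Finite) (hN : IsShiftInvariant Δ N) (k : ℕ) :
    k ∈ Δ ↔ leastInClass N Δ k ≤ k := by
  refine ⟨fun h => Nat.sInf_le ⟨h, rfl⟩, fun h => ?_⟩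
  obtain ⟨h1, h2⟩ := leastInClass_spec hΔ (k : ZMod N)
  obtain ⟨i, hi⟩ := (Nat.modEq_iff_dvd' h).1 ((ZMod.natCast_eq_natCast_iff _ _ _).1 h2)
  have hk : k = leastInClass N Δ k + N * i := by omega
  generalize leastInClass N Δ k = a at hk h1
  clear hi h h2
  subst hk
  induction i with
  | zero => simpa using h1
  | succ i ih =>
    rw [Nat.mul_succ, ← Nat.add_assoc]
    exact hN _ ih

theorem leastInClass_of_mem_generators [NeZero N] (hΔ : Δᶜ.Finite) (hN : IsShiftInvariant Δ N)
    {a : ℕ} (ha : a ∈ generators Δ N) : leastInClass N Δ a = a := by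
  have h1 := (mem_iff_leastInClass_le hΔ hN a).1 ha.1
  by_contra hne
  obtain ⟨i, hi⟩ := (Nat.modEq_iff_dvd' h1).1
    ((ZMod.natCast_eq_natCast_iff _ _ _).1 (leastInClass_spec hΔ (a : ZMod N)).2)
  have hN0 := NeZero.pos N
  have hi0 : i ≠ 0 := by
    rintro rfl
    omega
  obtain ⟨i, rfl⟩ := Nat.exists_eq_succ_of_ne_zero hi0
  rw [Nat.mul_succ] at hi
  refine ha.2 (a - N) ((mem_iff_leastInClass_le hΔ hN _).2 ?_) (by omega)
  rw [Nat.cast_sub (by omega), ZMod.natCast_self, sub_zero]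
  omega

theorem generators_eq_range [NeZero N] (hΔ : Δᶜ.Finite) (hN : IsShiftInvariant Δ N) :
    generators Δ N = Set.range (leastInClass N Δ) := by
  ext a
  refine ⟨fun ha => ⟨a, leastInClass_of_mem_generators hΔ hN ha⟩, ?_⟩
  rintro ⟨r, rfl⟩
  refine ⟨(leastInClass_spec hΔ r).1, fun b hb h => ?_⟩
  have h2 := (mem_iff_leastInClass_le hΔ hN b).1 hb
  have h3 : (b : ZMod N) = r := by
    rw [← (leastInClass_spec hΔ r).2, ← h]
    simp
  rw [h3] at h2
  have := NeZero.pos N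
  omega

end LeastElement

theorem exists_eq_add_mul {n m d : ℕ} [NeZero (n * d)] (hnm : Nat.Coprime n m) (hd : d ∣ n * d)
    (r r' : ZMod (n * d))
    (h : ZMod.castHom hd (ZMod d) r = ZMod.castHom hd (ZMod d) r') :
    ∃ i : ℕ, r' = r + i * ((m * d : ℕ) : ZMod (n * d)) := by
  have hn : NeZero n := ⟨fun h => NeZero.ne (n * d) (by rw [h, zero_mul])⟩
  obtain ⟨a, rfl⟩ := ZMod.natCast_zmod_surjective r
  obtain ⟨b, rfl⟩ := ZMod.natCast_zmod_surjective r'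
  rw [map_natCast, map_natCast, ZMod.natCast_eq_natCast_iff, Nat.modEq_iff_dvd] at h
  obtain ⟨k, hk⟩ := h
  refine ⟨((k : ZMod n) * (m : ZMod n)⁻¹).val, ?_⟩
  set i := ((k : ZMod n) * (m : ZMod n)⁻¹).val with hi
  have h1 : (i : ZMod n) * m = k := by
    rw [hi, ZMod.natCast_zmod_val, mul_assoc, mul_comm _ (m : ZMod n),
      ZMod.coe_mul_inv_eq_one m hnm.symm, mul_one]
  have h2 : ((k - i * m : ℤ) : ZMod n) = 0 := by
    push_cast
    rw [h1, sub_self]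
  obtain ⟨t, ht⟩ := (ZMod.intCast_zmod_eq_zero_iff_dvd _ _).1 h2
  have h3 : (((b : ℤ) - (a + i * (m * d : ℕ)) : ℤ) : ZMod (n * d)) = 0 := by
    rw [ZMod.intCast_zmod_eq_zero_iff_dvd]
    refine ⟨t, ?_⟩
    push_cast
    linear_combination hk + (d : ℤ) * ht
  push_cast at h3 ⊢
  exact sub_eq_zero.1 h3

/-- The combinatorial type of an admissible subset `Δ`. -/
noncomputable def admissibleStaircase {n m d : ℕ} [NeZero (n * d)] [NeZero d]
    (hnm : Nat.Coprime n m) {Δ : Set ℕ} (hΔ : Δᶜ.Finite) (hnd : IsShiftInvariant Δ (n * d))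
    (hmd : IsShiftInvariant Δ (m * d)) (hadm : IsAdmissible n m d Δ) :
    Staircase (n * d) d (m * d) where
  gen := leastInClass (n * d) Δ
  gen_add r := by
    have h := leastInClass_spec hΔ r
    have h1 := (mem_iff_leastInClass_le hΔ hnd _).1 (hmd _ h.1)
    rwa [Nat.cast_add, h.2] at h1
  dvd_N := dvd_mul_left d n
  dvd_M := dvd_mul_left d m
  exists_eq_add := exists_eq_add_mul hnm _
  admissible j := by
    unfold IsAdmissible IsSuspicious IsSuspiciousAt at hadm
    push Not at hadm
    obtain ⟨a, ha, haj, haΔ⟩ := hadm j.val (ZMod.val_lt j) one_pos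
    refine ⟨a, ?_, ?_⟩
    · rw [map_natCast, ← ZMod.natCast_zmod_val j, ZMod.natCast_eq_natCast_iff]
      exact haj
    · have := (mem_iff_leastInClass_le hΔ hnd _).1 haΔ
      rw [leastInClass_of_mem_generators hΔ hnd ha]
      push_cast at this ⊢
      exact this

theorem finsum_gaps {n m d : ℕ} [NeZero (n * d)] {T : Staircase (n * d) d (m * d)} {Δ : Set ℕ}
    (hgen : ∀ r, (T.gen r : ZMod (n * d)) = r) (hΔ : ∀ k : ℕ, k ∈ Δ ↔ T.gen k ≤ k)
    (hT : generators Δ (n * d) = Set.range T.gen) :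
    ∑ᶠ a ∈ generators Δ (n * d),
        (((gaps Δ a).ncard : ℤ) - ((gaps Δ (a + m * d)).ncard : ℤ)) =
      ∑ r, ((Nat.card {s // T.IsVar s r} : ℤ) - Nat.card {s // T.IsEqn s r}) := by
  have hinj : Function.Injective T.gen := fun a b h => by rw [← hgen a, h, hgen b]
  have hcard (a : ℕ) (Q : ℕ → Prop) (hQ : ∀ s, Q s ↔ a + s ∉ Δ) :
      (gaps Δ a).ncard = Nat.card {s // Q s} := by
    have e : gaps Δ a = (a + ·) '' {s | Q s} := by
      ext k
      constructor
      · rintro ⟨h1, h2⟩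
        obtain ⟨s, rfl⟩ := Nat.exists_eq_add_of_le h1
        exact ⟨s, (hQ s).2 h2, rfl⟩
      · rintro ⟨s, hs, rfl⟩
        exact ⟨Nat.le_add_right a s, (hQ s).1 hs⟩
    rw [e, Set.ncard_image_of_injective _ (add_right_injective a), ← Nat.card_coe_set_eq]
    rfl
  rw [hT, finsum_mem_range hinj, finsum_eq_sum_of_fintype]
  refine Finset.sum_congr rfl fun r _ => ?_
  rw [hcard _ _ fun s => isVar_iff hgen hΔ s r, hcard _ _ fun s => isEqn_iff hgen hΔ s r]

theorem Staircase.IsSolution.map {N d M : ℕ} {T : Staircase N d M} {R S : Type*} [CommRing R]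
    [CommRing S] {y : ℕ → R} {g : ℕ → ZMod N → R} (hg : T.IsSolution y g) (f : R →+* S) :
    T.IsSolution (fun i => f (y i)) fun s r => f (g s r) := by
  obtain ⟨c, hc, hyc⟩ := hg.exists_quot
  refine ⟨fun r => by rw [hg.zero, map_one], fun s hs r hr => by rw [hg.eq_zero s hs r hr, map_zero],
    fun s r => f (c s r), fun s r h => by simp only [hc s r h, map_zero], fun s r => ?_⟩
  have := congrArg f (hyc s r)
  simpa only [map_sum, map_mul] using this

theorem Staircase.coord_map {N d M : ℕ} {T : Staircase N d M} {P : Staircase.Pivots T}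
    {R S : Type*} [CommRing R] [CommRing S] (f : R →+* S) (g : ℕ → ZMod N → R) (p : ℕ × ZMod N) :
    Staircase.coord P (fun s r => f (g s r)) p = f (Staircase.coord P g p) := by
  simp only [Staircase.coord, map_sub, apply_ite f, map_zero]

namespace GenericCurve

variable {n m d : ℕ} (C : GenericCurve n m d) (R : Type) [CommRing R] [Algebra ℂ R]

theorem yCoeff_zero : C.yCoeff R 0 = 1 := by
  rw [yCoeff, add_zero, C.coeff_y_md, map_one]

theorem map_yCoeff {R S : Type} [CommRing R] [Algebra ℂ R] [CommRing S] [Algebra ℂ S]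
    (f : R →ₐ[ℂ] S) (i : ℕ) : f (C.yCoeff R i) = C.yCoeff S i := f.commutes _

open Classical in
theorem isUnit_sum_yCoeff_one [NeZero (n * d)] (T : Staircase (n * d) d (m * d)) (j : ZMod d) :
    IsUnit (∑ r with T.cl r = j, C.yCoeff R 1) := by
  obtain ⟨r, hr, -⟩ := T.admissible j
  have hpos : 0 < (Finset.univ.filter fun r => T.cl r = j).card :=
    Finset.card_pos.2 ⟨r, Finset.mem_filter.2 ⟨Finset.mem_univ r, hr⟩⟩
  rw [Finset.sum_const, yCoeff, ← map_nsmul, nsmul_eq_mul]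
  refine IsUnit.map _ (IsUnit.mk0 _ (mul_ne_zero ?_ C.coeff_y_md_succ))
  exact_mod_cast hpos.ne'

end GenericCurve

theorem theorem1p4 (n m d : ℕ) (C : GenericCurve n m d) (Δ : Set ℕ) (hcofinite : Δᶜ.Finite)
    (hnd : IsShiftInvariant Δ (n * d)) (hmd : IsShiftInvariant Δ (m * d)) (hadm : IsAdmissible n m d Δ) :
    ∃ D : ℕ,
      (D : ℤ) = ∑ᶠ a ∈ generators Δ (n * d),
        (((gaps Δ a).ncard : ℤ) - ((gaps Δ (a + m * d)).ncard : ℤ)) ∧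
      ∃ Φ : ∀ (R : Type) [CommRing R] [Algebra ℂ R], (Fin D → R) ≃ C.stratumPoints Δ R,
        ∀ (R S : Type) [CommRing R] [Algebra ℂ R] [CommRing S] [Algebra ℂ S]
          (f : R →ₐ[ℂ] S) (v : Fin D → R),
          (Φ S (fun i => f (v i)) : Submodule (C.functionRing S) S⟦X⟧) =
            C.baseChange f (Φ R v) := by
  classical
  have hN0 : NeZero (n * d) := ⟨(Nat.mul_pos C.n_pos C.d_pos).ne'⟩
  have hd0 : NeZero d := ⟨C.d_pos.ne'⟩
  let T := admissibleStaircase C.coprime hcofinite hnd hmd hadm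
  have hgen : ∀ r, (T.gen r : ZMod (n * d)) = r := fun r => (leastInClass_spec hcofinite r).2
  have hΔ : ∀ k : ℕ, k ∈ Δ ↔ T.gen k ≤ k := mem_iff_leastInClass_le hcofinite hnd
  obtain ⟨P⟩ := T.nonempty_pivots
  have hfin : Finite (Staircase.freeIndices P) := Staircase.finite_freeIndices P
  let e : Staircase.freeIndices P ≃ Fin (Nat.card (Staircase.freeIndices P)) := Finite.equivFin _
  refine ⟨Nat.card (Staircase.freeIndices P), ?_, ?_⟩
  · rw [finsum_gaps hgen hΔ (generators_eq_range hcofinite hnd)]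
    exact Staircase.card_freeIndices P
  have hsol (R : Type) [CommRing R] [Algebra ℂ R] (v : Fin (Nat.card (Staircase.freeIndices P)) → R) :
      ∃ g, T.IsSolution (C.yCoeff R) g ∧ ∀ p, Staircase.coord P g (e.symm p) = v p := by
    obtain ⟨g, hg, hv⟩ := Staircase.exists_solution P (C.yCoeff_zero R)
      (C.isUnit_sum_yCoeff_one R T)
      fun p => if h : p ∈ Staircase.freeIndices P then v (e ⟨p, h⟩) else 0
    exact ⟨g, hg, fun p => by rw [hv _ (e.symm p).2, dif_pos (e.symm p).2]; exact congrArg v (e.apply_symm_apply p)⟩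
  choose sol hsol1 hsol2 using @hsol
  have huniq (R : Type) [CommRing R] [Algebra ℂ R] {g g' : ℕ → ZMod (n * d) → R}
      (hg : T.IsSolution (C.yCoeff R) g) (hg' : T.IsSolution (C.yCoeff R) g')
      (h : ∀ p, Staircase.coord P g (e.symm p) = Staircase.coord P g' (e.symm p)) : g = g' := by
    refine hg.ext_coord (P := P) (C.yCoeff_zero R) (C.isUnit_sum_yCoeff_one R T) hg' fun p hp => ?_
    have := h (e ⟨p, hp⟩)
    rwa [e.symm_apply_apply] at this
  let L (R : Type) [CommRing R] [Algebra ℂ R] (v : Fin (Nat.card (Staircase.freeIndices P)) → R) :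
      C.stratumPoints Δ R :=
    ⟨latticeModule C hgen (sol R v) (hsol1 R v).zero ((hsol1 R v).y_mul_mem hgen),
      lattice_mem_stratumPoints hgen hΔ (hsol1 R v).zero fun _ => Iff.rfl⟩
  have hL (R : Type) [CommRing R] [Algebra ℂ R] : Function.Bijective (L R) := by
    constructor
    · intro v v' h
      have h1 : sol R v = sol R v' := by
        refine (hsol1 R v).ext_lattice hgen hΔ (hsol1 R v') (M := (L R v).1) (fun _ => Iff.rfl) ?_
        rw [h]
        exact fun _ => Iff.rfl
      funext p
      rw [← hsol2 R v p, h1, hsol2]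
    · rintro ⟨M, hM⟩
      obtain ⟨g, hg, hgM⟩ := exists_isSolution_of_mem_stratumPoints hgen hΔ hM
      refine ⟨fun p => Staircase.coord P g (e.symm p), Subtype.ext (SetLike.ext fun f => ?_)⟩
      have : sol R (fun p => Staircase.coord P g (e.symm p)) = g :=
        huniq R (hsol1 R _) hg fun p => hsol2 R _ p
      rw [hgM f]
      change f ∈ lattice T.gen (sol R _) ↔ _
      rw [this]
  refine ⟨fun R _ _ => Equiv.ofBijective (L R) (hL R), fun R S _ _ _ _ f v => ?_⟩
  have h1 : sol S (fun i => f (v i)) = fun s r => f (sol R v s r) := by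
    refine huniq S (hsol1 S _) ?_ fun p => ?_
    · have := (hsol1 R v).map (f : R →+* S)
      simpa only [RingHom.coe_coe, C.map_yCoeff] using this
    · rw [hsol2]
      exact (congrArg f (hsol2 R v p)).symm.trans (Staircase.coord_map (f : R →+* S) _ _).symm
  refine eq_baseChange (gen := T.gen) (g := sol R v) f (fun _ => Iff.rfl) fun a => ?_
  rw [← h1]
  exact Iff.rfl
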